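/- Conventions. A language $\mathcal L$ is a first-order language containing a distinguished binary relation symbol $<$; structures are nonempty; "definable" means definable with parameters. An $\mathcal L$-structure is o-minimal if it expands a dense linear order without endpoints and every definable subset of its universe is a finite union of points and open intervals with endpoints in $M\cup\{\pm\infty\}$. Let $T^{omin}_{\mathcal L}$ be the set of all $\mathcal L$-sentences true in every o-minimal $\mathcal L$-structure; an $\mathcal L$-structure is pseudo-o-minimal if it is a model of $T^{omin}_{\mathcal L}$. In an expansion of a dense linear order without endpoints $(M,<)$, a definable set $X\subseteq M^n$ is pseudo-finite if it is closed, bounded and discrete (for the product of the order topologies); the structure has the pigeonhole principle if for every $n$ and every pseudo-finite $X\subseteq M^n$, every definable injective map $f:X\to X$ is surjective. For a first-order sentence $\tau$ in the language $\{<,U\}$, $U$ a unary predicate, let $T_\tau$ be the set of all $\mathcal L$-sentences $\forall\bar y\,\tau_\varphi(\bar y)$, where $\varphi(x;\bar y)$ ranges over all $\mathcal L$-formulae with a single object variable $x$ and a finite tuple $\bar y$ of parameter variables, and $\tau_\varphi$ is obtained from $\tau$ by replacing every instance $U(v)$ by $\varphi(v;\bar y)$. Let $\mathcal L_{\mathrm{Def}}=\{<,\mathrm{Def}\}$,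 where $\mathrm{Def}$ is a predicate on subsets of the universe. Every $\mathcal L$-structure is regarded as an $\mathcal L_{\mathrm{Def}}$-structure, with $\mathrm{Def}$ interpreted as the family of its definable one-variable subsets; second-order sentences of $\mathcal L_{\mathrm{Def}}$ are evaluated in full second-order semantics. Theorem. There is a language $\mathcal L$ such that: 1. There are two $\mathcal L$-structures $\mathcal M,\mathcal N$ on the same universe $M$ which both expand the same dense linear order without endpoints $(M,<)$ and have the same definable subsets of $M$, such that $\mathcal M$ is pseudo-o-minimal, whereas $\mathcal N$ does not have the pigeonhole principle and is not pseudo-o-minimal. 2. Pseudo-o-minimality of $\mathcal L$-structures has no axiomatization by first-order conditions on one-variable formulae: there is no set $C$ of $\{<,U\}$-sentences such that the models of $\bigcup_{\tau\in C}T_\tau$ are exactly the pseudo-o-minimal $\mathcal L$-structures. 3. Pseudo-o-minimality of $\mathcal L$-structures has no axiomatization by a second-order theory in the language $\mathcal L_{\mathrm{Def}}$: there is no set $T$ of second-order $\mathcal L_{\mathrm{Def}}$-sentences such that the $\mathcal L$-structures satisfying $T$ are exactly the pseudo-o-minimal ones. -/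

import Mathlib

open FirstOrder FirstOrder.Language

namespace PseudoOMin

/-- A language with a distinguished binary relation symbol `<`. -/
class HasLt (L : FirstOrder.Language.{0, 0}) where
  ltSymb : L.Relations 2

section Structures

variable {L : FirstOrder.Language.{0, 0}} {M : Type}

/-- The interpretation of the symbol `<` in a structure. -/
def ltRel [HasLt L] (S : L.Structure M) (a b : M) : Prop :=
  S.RelMap (HasLt.ltSymb : L.Relations 2) ![a, b]

/-- The subsets of the universe that are definable in one variable, with parameters. -/
def definableSets (S : L.Structure M) : Set (Set M) :=
  {A | (Set.univ : Set M).Definable₁ L A}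

/-- `S` is an expansion of the (nonempty) dense linear order without endpoints `(M, <)`. -/
structure ExpandsDLO [HasLt L] [LinearOrder M] (S : L.Structure M) : Prop where
  nonempty : Nonempty M
  dense : DenselyOrdered M
  noMin : NoMinOrder M
  noMax : NoMaxOrder M
  lt_iff : ∀ a b : M, ltRel S a b ↔ a < b

/-- A point, or an open interval with endpoints in `M ∪ {-∞, +∞}`. -/
def IsPointOrInterval [LinearOrder M] (I : Set M) : Prop :=
  (∃ a, I = {a}) ∨ (∃ a b, I = Set.Ioo a b) ∨ (∃ a, I = Set.Ioi a) ∨ (∃ b, I = Set.Iio b) ∨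
    I = Set.univ

/-- An o-minimal structure: an expansion of a dense linear order without endpoints in which every
definable subset of the universe is a finite union of points and open intervals. -/
structure IsOMinimal [HasLt L] [LinearOrder M] (S : L.Structure M) : Prop
    extends ExpandsDLO S where
  omin : ∀ A ∈ definableSets S, ∃ F : Set (Set M),
    F.Finite ∧ (∀ I ∈ F, IsPointOrInterval I) ∧ A = ⋃₀ F

/-- The set of all `L`-sentences that are satisfied in every o-minimal `L`-structure. -/
def ominTheory (L : FirstOrder.Language.{0, 0}) [HasLt L] : L.Theory :=
  {σ | ∀ (M : Type) (_ : LinearOrder M) (S : L.Structure M), IsOMinimal S → M ⊨ σ}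

/-- A structure is pseudo-o-minimal if it is a model of the common theory of the o-minimal
structures in its language. -/
def IsPseudoOMinimal [HasLt L] (S : L.Structure M) : Prop :=
  M ⊨ ominTheory L

/-- A definable subset of `M ^ n` is pseudo-finite if it is closed, bounded and discrete, with
respect to the product of the order topologies. -/
def IsPseudoFinite [LinearOrder M] (S : L.Structure M) {n : ℕ} (X : Set (Fin n → M)) : Prop :=
  letI : TopologicalSpace M := Preorder.topology M
  (Set.univ : Set M).Definable L X ∧ IsClosed X ∧ (BddBelow X ∧ BddAbove X) ∧ IsDiscrete X

/-- The graph of a self-map of a subset of `M ^ n`, as a subset of `M ^ (n + n)`. -/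
def graphOf {n : ℕ} {X : Set (Fin n → M)} (f : X → X) : Set (Fin n ⊕ Fin n → M) :=
  {z | ∃ x : X, z = Sum.elim (x : Fin n → M) (f x : Fin n → M)}

/-- The pigeonhole principle: every definable injective self-map of a pseudo-finite set is
surjective. -/
def PigeonholePrinciple [LinearOrder M] (S : L.Structure M) : Prop :=
  ∀ (n : ℕ) (X : Set (Fin n → M)), IsPseudoFinite S X →
    ∀ f : X → X, (Set.univ : Set M).Definable L (graphOf f) →
      Function.Injective f → Function.Surjective f

end Structures

section OneVariableConditions

/-- The relation symbols `<` (binary) and `U` (unary). -/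
inductive LtURel : ℕ → Type
  | lt : LtURel 2
  | U : LtURel 1

/-- The language `{<, U}`. -/
abbrev langLtU : FirstOrder.Language.{0, 0} := ⟨fun _ => Empty, LtURel⟩

/-- Every term of the language `{<, U}` is a variable. In a formula without free variables it is
one of the variables bound by the quantifiers. -/
def varOf {n : ℕ} : langLtU.Term (Empty ⊕ Fin n) → Fin n
  | .var (.inr i) => i
  | .var (.inl e) => e.elim
  | .func f _ => Empty.elim f

variable {L : FirstOrder.Language.{0, 0}} [HasLt L]

/-- The formula obtained from `τ` by replacing each instance `U(v)` by `φ(v; y)`, where `φ(x; y)`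
has the object variable `x` (the variable `Sum.inr 0`) and the tuple `y` of parameter variables
(the variables `Sum.inl j`). -/
def replaceU {k : ℕ} (φ : L.Formula (Fin k ⊕ Fin 1)) :
    ∀ {n : ℕ}, langLtU.BoundedFormula Empty n → L.BoundedFormula (Fin k) n
  | _, .falsum => .falsum
  | _, .equal t s => .equal (.var (.inr (varOf t))) (.var (.inr (varOf s)))
  | _, .rel LtURel.lt ts => (HasLt.ltSymb : L.Relations 2).boundedFormula₂
      (.var (.inr (varOf (ts 0)))) (.var (.inr (varOf (ts 1))))
  | _, .rel LtURel.U ts =>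
      BoundedFormula.relabel (Sum.elim Sum.inl fun _ => Sum.inr (varOf (ts 0))) φ
  | _, .imp τ₁ τ₂ => .imp (replaceU φ τ₁) (replaceU φ τ₂)
  | _, .all τ => .all (replaceU φ τ)

/-- The sentence `∀ y, τ_φ(y)`. -/
noncomputable def conditionInstance (τ : langLtU.Sentence) {k : ℕ}
    (φ : L.Formula (Fin k ⊕ Fin 1)) : L.Sentence :=
  Formula.iAlls (α := Empty) (Fin k) (Formula.relabel Sum.inr (replaceU φ τ : L.Formula (Fin k)))

/-- The first-order condition on one-variable formulae given by the `{<, U}`-sentence `τ`: the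
scheme of all sentences `∀ y, τ_φ(y)`, where `φ(x; y)` ranges over all partitioned `L`-formulae with
a single object variable. -/
def conditionScheme (L : FirstOrder.Language.{0, 0}) [HasLt L] (τ : langLtU.Sentence) : L.Theory :=
  {σ | ∃ (k : ℕ) (φ : L.Formula (Fin k ⊕ Fin 1)), σ = conditionInstance τ φ}

end OneVariableConditions

section SecondOrder

/-- Formulae of second-order logic in the language `{<, Def}`, where `Def` is a predicate on unary
second-order variables. In `SOFormula n Γ` there are `n` free first-order variables, and one free
second-order (relation) variable for every entry of the list `Γ`, whose arity is that entry. -/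
inductive SOFormula : ℕ → List ℕ → Type
  | falsum {n : ℕ} {Γ : List ℕ} : SOFormula n Γ
  | equal {n : ℕ} {Γ : List ℕ} (i j : Fin n) : SOFormula n Γ
  | lt {n : ℕ} {Γ : List ℕ} (i j : Fin n) : SOFormula n Γ
  | mem {n : ℕ} {Γ : List ℕ} (X : Fin Γ.length) (t : Fin (Γ.get X) → Fin n) : SOFormula n Γ
  | isDef {n : ℕ} {Γ : List ℕ} (X : Fin Γ.length) (hX : Γ.get X = 1) : SOFormula n Γ
  | imp {n : ℕ} {Γ : List ℕ} (φ ψ : SOFormula n Γ) : SOFormula n Γ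
  | all {n : ℕ} {Γ : List ℕ} (φ : SOFormula (n + 1) Γ) : SOFormula n Γ
  | allRel {n : ℕ} {Γ : List ℕ} (k : ℕ) (φ : SOFormula n (k :: Γ)) : SOFormula n Γ

/-- Values for the relation variables of a list of arities. -/
abbrev RelEnv (M : Type) (Γ : List ℕ) : Type :=
  ∀ X : Fin Γ.length, Set (Fin (Γ.get X) → M)

/-- Add a value for a new relation variable in front. -/
def RelEnv.cons {M : Type} {Γ : List ℕ} {k : ℕ} (R : Set (Fin k → M)) (V : RelEnv M Γ) :
    RelEnv M (k :: Γ) :=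
  Fin.cons (α := fun X : Fin (Γ.length + 1) => Set (Fin ((k :: Γ).get X) → M)) R V

/-- Full second-order semantics, for a universe `M` with a binary relation `lt` and a family `D` of
subsets of `M` that interprets `Def`. -/
def SOFormula.Realize {M : Type} (lt : M → M → Prop) (D : Set (Set M)) :
    ∀ {n : ℕ} {Γ : List ℕ}, SOFormula n Γ → (Fin n → M) → RelEnv M Γ → Prop
  | _, _, .falsum, _, _ => False
  | _, _, .equal i j, v, _ => v i = v j
  | _, _, .lt i j, v, _ => lt (v i) (v j)
  | _, _, .mem X t, v, V => (fun a => v (t a)) ∈ V X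
  | _, _, .isDef X _, _, V => {a : M | (fun _ => a) ∈ V X} ∈ D
  | _, _, .imp φ ψ, v, V => φ.Realize lt D v V → ψ.Realize lt D v V
  | _, _, .all φ, v, V => ∀ a : M, φ.Realize lt D (Fin.snoc v a) V
  | _, _, .allRel k φ, v, V => ∀ R : Set (Fin k → M), φ.Realize lt D v (RelEnv.cons R V)

/-- Second-order sentences in the language `{<, Def}`. -/
abbrev SOSentence : Type := SOFormula 0 []

/-- `S` satisfies a second-order sentence, where `<` is interpreted as in `S` and `Def` as the
family of the one-variable definable sets of `S`. -/
def SOSatisfies {L : FirstOrder.Language.{0, 0}} [HasLt L] {M : Type} (S : L.Structure M)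
    (σ : SOSentence) : Prop :=
  σ.Realize (ltRel S) (definableSets S) Fin.elim0 (fun X => Fin.elim0 X)

end SecondOrder

end PseudoOMin

namespace PseudoOMin

section OneVariable

variable {L : FirstOrder.Language.{0, 0}} {M : Type}

/-- The `{<, U}`-structure with universe `M` in which `U` is interpreted as `A`. -/
@[reducible] def ltUStructure (lt : M → M → Prop) (A : Set M) : langLtU.Structure M where
  funMap := fun f _ => Empty.elim f
  RelMap := fun r xs => match r with
    | LtURel.lt => lt (xs 0) (xs 1)
    | LtURel.U => xs 0 ∈ A

theorem realize_langLtU_term (S : langLtU.Structure M) {n : ℕ} (v : Empty → M) (xs : Fin n → M)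
    (t : langLtU.Term (Empty ⊕ Fin n)) : t.realize (Sum.elim v xs) = xs (varOf t) := by
  rcases t with (e | i) | ⟨f, _⟩
  · exact e.elim
  · rfl
  · exact Empty.elim f

theorem realize_replaceU [HasLt L] (S : L.Structure M) {k : ℕ} (φ : L.Formula (Fin k ⊕ Fin 1))
    (ys : Fin k → M) {n : ℕ} (τ : langLtU.BoundedFormula Empty n) (v : Empty → M)
    (xs : Fin n → M) :
    (replaceU φ τ).Realize ys xs ↔
      letI := ltUStructure (ltRel S) {a | φ.Realize (Sum.elim ys fun _ => a)}
      τ.Realize v xs := by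
  induction τ with
  | falsum => exact Iff.rfl
  | equal t s =>
    simp only [replaceU, BoundedFormula.Realize, realize_langLtU_term]
    rfl
  | rel R ts =>
    cases R with
    | lt =>
      simp only [replaceU, BoundedFormula.Realize, realize_langLtU_term,
        BoundedFormula.realize_rel₂]
      rfl
    | U =>
      simp only [replaceU, BoundedFormula.Realize, realize_langLtU_term,
        BoundedFormula.realize_relabel]
      change _ ↔ φ.Realize (Sum.elim ys fun _ => xs (varOf (ts 0)))
      rw [Formula.Realize]
      have h : (Sum.elim ys (xs ∘ Fin.castAdd 0) ∘
          (Sum.elim Sum.inl fun _ => Sum.inr (varOf (ts 0)) : Fin k ⊕ Fin 1 → Fin k ⊕ Fin _)) =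
          Sum.elim ys fun _ => xs (varOf (ts 0)) := by
        funext i
        rcases i with i | i <;> rfl
      rw [h]
      exact iff_of_eq (congrArg (BoundedFormula.Realize φ _) (Subsingleton.elim _ _))
  | imp _ _ ih₁ ih₂ =>
    simp only [replaceU, BoundedFormula.Realize, ih₁, ih₂]
  | all _ ih =>
    simp only [replaceU, BoundedFormula.Realize, ih]

theorem realize_conditionInstance [HasLt L] (S : L.Structure M) (τ : langLtU.Sentence) {k : ℕ}
    (φ : L.Formula (Fin k ⊕ Fin 1)) :
    M ⊨ conditionInstance τ φ ↔ ∀ ys : Fin k → M,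
      letI := ltUStructure (ltRel S) {a | φ.Realize (Sum.elim ys fun _ => a)}
      M ⊨ τ := by
  rw [Sentence.Realize, conditionInstance, Formula.realize_iAlls]
  refine forall_congr' fun ys => ?_
  rw [Formula.realize_relabel]
  exact realize_replaceU S φ ys τ default default

/-- A one-variable definable set is defined by a formula with finitely many parameters. -/
theorem mem_definableSets_iff (S : L.Structure M) (A : Set M) :
    A ∈ definableSets S ↔ ∃ (k : ℕ) (φ : L.Formula (Fin k ⊕ Fin 1)) (ys : Fin k → M),
      A = {a | φ.Realize (Sum.elim ys fun _ => a)} := by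
  constructor
  · intro h
    obtain ⟨A₀, -, h⟩ := Set.definable_iff_finitely_definable.1 h
    obtain ⟨φ, h⟩ := Set.definable_iff_exists_formula_sum.1 h
    refine ⟨A₀.card, φ.relabel (Sum.map A₀.equivFin id), fun i => A₀.equivFin.symm i, ?_⟩
    ext a
    have h' := Set.ext_iff.1 h fun _ => a
    simp only [Set.mem_ofPred_eq, Formula.realize_relabel] at h' ⊢
    rw [h']
    refine iff_of_eq (congrArg _ ?_)
    funext i
    rcases i with i | i
    · exact congrArg Subtype.val (A₀.equivFin.symm_apply_apply i).symm
    · rfl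
  · rintro ⟨k, φ, ys, rfl⟩
    refine Set.definable_iff_exists_formula_sum.2
      ⟨φ.relabel (Sum.map (fun i => ⟨ys i, trivial⟩) id), ?_⟩
    ext x
    simp only [Set.mem_ofPred_eq, Formula.realize_relabel]
    refine iff_of_eq (congrArg _ ?_)
    funext i
    rcases i with i | i
    · rfl
    · exact congrArg x (Subsingleton.elim _ _)

theorem models_conditionScheme_iff [HasLt L] (S : L.Structure M) (τ : langLtU.Sentence) :
    M ⊨ conditionScheme L τ ↔ ∀ A ∈ definableSets S,
      letI := ltUStructure (ltRel S) A
      M ⊨ τ := by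
  rw [Theory.model_iff]
  constructor
  · intro h A hA
    obtain ⟨k, φ, ys, rfl⟩ := (mem_definableSets_iff S A).1 hA
    exact (realize_conditionInstance S τ φ).1 (h _ ⟨k, φ, rfl⟩) ys
  · rintro h _ ⟨k, φ, rfl⟩
    exact (realize_conditionInstance S τ φ).2 fun ys =>
      h _ ((mem_definableSets_iff S _).2 ⟨k, φ, ys, rfl⟩)

theorem models_iUnion_conditionScheme_iff [HasLt L] (S : L.Structure M)
    (C : Set langLtU.Sentence) :
    M ⊨ (⋃ τ ∈ C, conditionScheme L τ : L.Theory) ↔ ∀ τ ∈ C, ∀ A ∈ definableSets S,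
      letI := ltUStructure (ltRel S) A
      M ⊨ τ := by
  simp only [← models_conditionScheme_iff, Theory.model_iff, Set.mem_iUnion]
  exact ⟨fun h τ hτ σ hσ => h σ ⟨τ, hτ, hσ⟩, fun h σ ⟨τ, hτ, hσ⟩ => h τ hτ σ hσ⟩

/-- Two structures with the same order and the same one-variable definable sets satisfy the same
first-order conditions on one-variable formulae. -/
theorem models_iUnion_conditionScheme_congr [HasLt L] {S₁ S₂ : L.Structure M}
    (hlt : ltRel S₁ = ltRel S₂) (hdef : definableSets S₁ = definableSets S₂)
    (C : Set langLtU.Sentence)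
    (h : letI := S₁; M ⊨ (⋃ τ ∈ C, conditionScheme L τ : L.Theory)) :
    letI := S₂; M ⊨ (⋃ τ ∈ C, conditionScheme L τ : L.Theory) := by
  rw [models_iUnion_conditionScheme_iff] at h ⊢
  rwa [← hlt, ← hdef]

theorem SOSatisfies_congr [HasLt L] {S₁ S₂ : L.Structure M}
    (hlt : ltRel S₁ = ltRel S₂) (hdef : definableSets S₁ = definableSets S₂) (σ : SOSentence)
    (h : SOSatisfies S₁ σ) : SOSatisfies S₂ σ := by
  rwa [SOSatisfies, ← hlt, ← hdef]

theorem ExpandsDLO.ltRel_eq [HasLt L] [LinearOrder M] {S₁ S₂ : L.Structure M}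
    (h₁ : ExpandsDLO S₁) (h₂ : ExpandsDLO S₂) : ltRel S₁ = ltRel S₂ := by
  funext a b
  rw [h₁.lt_iff, h₂.lt_iff]

end OneVariable

section BackForth

variable {L : FirstOrder.Language.{0, 0}} {M N : Type} [L.Structure M] [L.Structure N]

/-- The quantifier depth of a formula. -/
def quantifierDepth {α : Type} : ∀ {n : ℕ}, L.BoundedFormula α n → ℕ
  | _, .falsum => 0
  | _, .equal _ _ => 0
  | _, .rel _ _ => 0
  | _, .imp φ ψ => max (quantifierDepth φ) (quantifierDepth ψ)
  | _, .all φ => quantifierDepth φ + 1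

/-- A graded back-and-forth system between two structures in a relational language: `E r P` says
that the finite partial correspondence `P` can be extended `r` times. -/
structure BackForth (L : FirstOrder.Language.{0, 0}) (M N : Type) [L.Structure M]
    [L.Structure N] (E : ℕ → Set (M × N) → Prop) : Prop where
  anti : ∀ {r P}, E (r + 1) P → E r P
  eq_iff : ∀ {P}, E 0 P → ∀ p ∈ P, ∀ q ∈ P, p.1 = q.1 ↔ p.2 = q.2
  rel_iff : ∀ {P}, E 0 P → ∀ {n} (R : L.Relations n) (xs : Fin n → M × N), (∀ i, xs i ∈ P) →
    (Structure.RelMap R (fun i => (xs i).1) ↔ Structure.RelMap R (fun i => (xs i).2))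
  forth : ∀ {r P}, E (r + 1) P → ∀ a, ∃ b, E r (insert (a, b) P)
  back : ∀ {r P}, E (r + 1) P → ∀ b, ∃ a, E r (insert (a, b) P)

theorem BackForth.anti_le {E : ℕ → Set (M × N) → Prop} (h : BackForth L M N E) {r s : ℕ}
    (hrs : r ≤ s) {P : Set (M × N)} (hP : E s P) : E r P := by
  induction hrs with
  | refl => exact hP
  | step _ ih => exact ih (h.anti hP)

theorem exists_eq_var [L.IsRelational] {α : Type} (t : L.Term α) : ∃ i, t = .var i := by
  rcases t with i | ⟨f, _⟩
  · exact ⟨i, rfl⟩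
  · exact isEmptyElim f

theorem BackForth.realize_iff [L.IsRelational] {E : ℕ → Set (M × N) → Prop}
    (h : BackForth L M N E) {α : Type} {n : ℕ} (φ : L.BoundedFormula α n) (v : α → M × N)
    (xs : Fin n → M × N) {P : Set (M × N)} (hv : ∀ i, v i ∈ P) (hxs : ∀ i, xs i ∈ P)
    (hP : E (quantifierDepth φ) P) :
    φ.Realize (fun i => (v i).1) (fun i => (xs i).1) ↔
      φ.Realize (fun i => (v i).2) (fun i => (xs i).2) := by
  have key : ∀ {n : ℕ} (xs : Fin n → M × N) (t : L.Term (α ⊕ Fin n)), (∀ i, xs i ∈ P) →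
      ∃ p ∈ P, t.realize (Sum.elim (fun i => (v i).1) (fun i => (xs i).1)) = p.1 ∧
        t.realize (Sum.elim (fun i => (v i).2) (fun i => (xs i).2)) = p.2 := by
    intro n xs t hxs
    obtain ⟨i | i, rfl⟩ := exists_eq_var t
    · exact ⟨v i, hv i, rfl, rfl⟩
    · exact ⟨xs i, hxs i, rfl, rfl⟩
  induction φ generalizing P with
  | falsum => exact Iff.rfl
  | equal t s =>
    obtain ⟨p, hp, hp₁, hp₂⟩ := key xs t hxs
    obtain ⟨q, hq, hq₁, hq₂⟩ := key xs s hxs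
    simp only [BoundedFormula.Realize, hp₁, hp₂, hq₁, hq₂]
    exact h.eq_iff hP p hp q hq
  | rel R ts =>
    choose p hp hp₁ hp₂ using fun i => key xs (ts i) hxs
    simp only [BoundedFormula.Realize, hp₁, hp₂]
    exact h.rel_iff hP R p hp
  | imp φ ψ ih₁ ih₂ =>
    exact imp_congr (ih₁ xs hv hxs (h.anti_le (le_max_left _ _) hP) key)
      (ih₂ xs hv hxs (h.anti_le (le_max_right _ _) hP) key)
  | @all n φ ih =>
    simp only [BoundedFormula.Realize]
    have step : ∀ a b, E (quantifierDepth φ) (insert (a, b) P) →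
        (φ.Realize (fun i => (v i).1) (Fin.snoc (fun i => (xs i).1) a) ↔
          φ.Realize (fun i => (v i).2) (Fin.snoc (fun i => (xs i).2) b)) := by
      intro a b hab
      have hv' : ∀ i, v i ∈ insert (a, b) P := fun i => Or.inr (hv i)
      have hxs' : ∀ i, Fin.snoc (α := fun _ => M × N) xs (a, b) i ∈ insert (a, b) P := by
        intro i
        refine Fin.lastCases ?_ (fun i => ?_) i
        · simp
        · simpa using Or.inr (hxs i)
      have h' := ih (Fin.snoc (α := fun _ => M × N) xs (a, b)) hv' hxs' hab (by
        intro n xs t hxs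
        obtain ⟨i | i, rfl⟩ := exists_eq_var t
        · exact ⟨v i, hv' i, rfl, rfl⟩
        · exact ⟨xs i, hxs i, rfl, rfl⟩)
      have e₁ : (fun i => (Fin.snoc (α := fun _ => M × N) xs (a, b) i).1) =
          Fin.snoc (α := fun _ => M) (fun i => (xs i).1) a := by
        funext i
        refine Fin.lastCases ?_ (fun i => ?_) i <;> simp
      have e₂ : (fun i => (Fin.snoc (α := fun _ => M × N) xs (a, b) i).2) =
          Fin.snoc (α := fun _ => N) (fun i => (xs i).2) b := by
        funext i
        refine Fin.lastCases ?_ (fun i => ?_) i <;> simp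
      rwa [e₁, e₂] at h'
    constructor
    · intro H b
      obtain ⟨a, ha⟩ := h.back hP b
      exact (step a b ha).1 (H a)
    · intro H a
      obtain ⟨b, hb⟩ := h.forth hP a
      exact (step a b hb).2 (H b)

end BackForth

section Shifts

variable {A A' : Type} [AddCommGroup A] [LinearOrder A] [AddCommGroup A'] [LinearOrder A']

/-- A positive element `one` that is the least positive element, and a positive element `top`. -/
structure Base (A : Type) [AddCommGroup A] [LinearOrder A] where
  one : A
  top : A
  one_pos : 0 < one
  one_le : ∀ x, 0 < x → one ≤ x
  top_pos : 0 < top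

/-- A pair of adjoint self-maps of a discretely ordered group. -/
structure Shift (B : Base A) where
  up : A → A
  down : A → A
  gc : GaloisConnection down up

/-- Names for the translations by `one` and `top`, their inverses, and the two maps of a shift. -/
inductive Letter
  | succ | pred | next | prev | up | down

instance : Finite Letter :=
  Finite.of_surjective ![Letter.succ, .pred, .next, .prev, .up, .down] fun l => by
    cases l
    exacts [⟨0, rfl⟩, ⟨1, rfl⟩, ⟨2, rfl⟩, ⟨3, rfl⟩, ⟨4, rfl⟩, ⟨5, rfl⟩]

variable {B : Base A} {B' : Base A'}

/-- The action of a letter. -/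
def Shift.act (G : Shift B) : Letter → A → A
  | .succ, x => x + B.one
  | .pred, x => x - B.one
  | .next, x => x + B.top
  | .prev, x => x - B.top
  | .up, x => G.up x
  | .down, x => G.down x

/-- The action of a word; the last letter acts first. -/
def Shift.word (G : Shift B) (w : List Letter) (x : A) : A :=
  w.foldr G.act x

@[simp] theorem Shift.word_nil (G : Shift B) (x : A) : G.word [] x = x := rfl

@[simp] theorem Shift.word_cons (G : Shift B) (l : Letter) (w : List Letter) (x : A) :
    G.word (l :: w) x = G.act l (G.word w x) := rfl

theorem Shift.word_append (G : Shift B) (w v : List Letter) (x : A) :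
    G.word (w ++ v) x = G.word w (G.word v x) := by
  simp [Shift.word]

/-- The adjoint of a letter. -/
def letterAdjoint : Letter → List Letter
  | .succ => [.pred]
  | .pred => [.succ]
  | .next => [.prev]
  | .prev => [.next]
  | .up => [.down]
  | .down => [.succ, .up, .pred]

/-- The adjoint of a word. -/
def wordAdjoint (w : List Letter) : List Letter :=
  w.reverse.flatMap letterAdjoint

theorem wordAdjoint_cons (l : Letter) (w : List Letter) :
    wordAdjoint (l :: w) = wordAdjoint w ++ letterAdjoint l := by
  simp [wordAdjoint]

theorem length_wordAdjoint_le (w : List Letter) : (wordAdjoint w).length ≤ 3 * w.length := by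
  induction w with
  | nil => simp [wordAdjoint]
  | cons l w ih =>
    have : (letterAdjoint l).length ≤ 3 := by cases l <;> simp [letterAdjoint]
    rw [wordAdjoint_cons, List.length_append, List.length_cons]
    lia

/-- Two families of pairs of points are ordered alike, also after moving them by words of length at
most `R`. -/
def Agree (G : Shift B) (G' : Shift B') (R : ℕ) (Q : Set (A × A')) : Prop :=
  ∀ p ∈ Q, ∀ q ∈ Q, ∀ w : List Letter, w.length ≤ R →
    (G.word w p.1 < q.1 ↔ G'.word w p.2 < q.2)

/-- The points `x` and `x'` lie in the same cut of the images of the pair `q` under words of length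
at most `k`. -/
def SameCut (G : Shift B) (G' : Shift B') (k : ℕ) (q : A × A') (x : A) (x' : A') : Prop :=
  ∀ w : List Letter, w.length ≤ k →
    (G.word w q.1 < x ↔ G'.word w q.2 < x') ∧ (x < G.word w q.1 ↔ x' < G'.word w q.2)

/-- Points in the same cut of the images of `0` are moved alike by words. -/
def MovesAlike (G : Shift B) (G' : Shift B') (R : ℕ) : Prop :=
  ∀ x x', -B.one ≤ x → x ≤ B.top → -B'.one ≤ x' → x' ≤ B'.top →
    SameCut G G' (3 * R + 3) (0, 0) x x' → ∀ w : List Letter, w.length ≤ R →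
      (G.word w x < x ↔ G'.word w x' < x')

variable {G : Shift B} {G' : Shift B'} {R k : ℕ} {Q : Set (A × A')}

theorem Agree.mono (h : Agree G G' R Q) {S : ℕ} (hS : S ≤ R) : Agree G G' S Q :=
  fun p hp q hq w hw => h p hp q hq w (hw.trans hS)

theorem Agree.swap (h : Agree G G' R Q) : Agree G' G R (Prod.swap ⁻¹' Q) :=
  fun p hp q hq w hw => (h p.swap hp q.swap hq w hw).symm

theorem SameCut.swap {q : A × A'} {x : A} {x' : A'} (h : SameCut G G' k q x x') :
    SameCut G' G k q.swap x' x :=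
  fun w hw => ⟨(h w hw).1.symm, (h w hw).2.symm⟩

theorem MovesAlike.swap (h : MovesAlike G G' R) : MovesAlike G' G R :=
  fun x x' h₁ h₂ h₃ h₄ hc w hw => (h x' x h₃ h₄ h₁ h₂ hc.swap w hw).symm

section Order

variable [IsOrderedAddMonoid A] [IsOrderedAddMonoid A']

theorem Base.lt_iff (B : Base A) {x y : A} : x < y ↔ x + B.one ≤ y := by
  constructor
  · intro h
    have := B.one_le (y - x) (sub_pos.2 h)
    rwa [add_comm, ← le_sub_iff_add_le]
  · intro h
    exact lt_of_lt_of_le (lt_add_of_pos_right x B.one_pos) h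

theorem Base.le_iff (B : Base A) {x y : A} : x ≤ y ↔ x < y + B.one := by
  rw [B.lt_iff, add_le_add_iff_right]

theorem Shift.act_lt_iff (G : Shift B) (l : Letter) (x y : A) :
    G.act l x < y ↔ x < G.word (letterAdjoint l) y := by
  cases l with
  | succ => exact lt_sub_iff_add_lt.symm
  | pred => exact sub_lt_iff_lt_add
  | next => exact lt_sub_iff_add_lt.symm
  | prev => exact sub_lt_iff_lt_add
  | up => exact G.gc.lt_iff_lt.symm
  | down =>
    change G.down x < y ↔ x < G.up (y - B.one) + B.one
    rw [← B.le_iff, ← G.gc x, B.lt_iff, le_sub_iff_add_le]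

theorem Shift.word_lt_iff (G : Shift B) (w : List Letter) (x y : A) :
    G.word w x < y ↔ x < G.word (wordAdjoint w) y := by
  induction w generalizing y with
  | nil => exact Iff.rfl
  | cons l w ih => rw [Shift.word_cons, G.act_lt_iff, ih, wordAdjoint_cons, G.word_append]

theorem Shift.lt_word_iff (G : Shift B) (w : List Letter) (x y : A) :
    x < G.word w y ↔ ¬ G.word (.pred :: w) y < x := by
  rw [← not_le, B.le_iff]
  exact not_congr sub_lt_iff_lt_add.symm

theorem Agree.lt_word_iff (h : Agree G G' R Q) {p q : A × A'} (hp : p ∈ Q) (hq : q ∈ Q)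
    {w : List Letter} (hw : w.length + 1 ≤ R) :
    p.1 < G.word w q.1 ↔ p.2 < G'.word w q.2 := by
  rw [G.lt_word_iff, G'.lt_word_iff, h q hq p hp _ (by simpa using hw)]

theorem Agree.word_lt_word_iff (h : Agree G G' R Q) {p q : A × A'} (hp : p ∈ Q) (hq : q ∈ Q)
    {w v : List Letter} (hw : w.length ≤ k) (hv : v.length ≤ k) (hk : 4 * k + 1 ≤ R) :
    G.word w p.1 < G.word v q.1 ↔ G'.word w p.2 < G'.word v q.2 := by
  rw [G.word_lt_iff, G'.word_lt_iff, ← G.word_append, ← G'.word_append]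
  refine h.lt_word_iff hp hq ?_
  have := length_wordAdjoint_le w
  rw [List.length_append]
  lia

theorem Agree.insert (h : Agree G G' R Q) (hm : MovesAlike G G' R) (h₀ : (0, 0) ∈ Q) {x : A}
    {x' : A'} (hx₀ : -B.one ≤ x) (hx₁ : x ≤ B.top) (hx₀' : -B'.one ≤ x') (hx₁' : x' ≤ B'.top)
    (hc : ∀ q ∈ Q, SameCut G G' (3 * R + 3) q x x') :
    Agree G G' R (insert (x, x') Q) := by
  rintro p (rfl | hp) q (rfl | hq) w hw
  · exact hm x x' hx₀ hx₁ hx₀' hx₁' (hc _ h₀) w hw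
  · rw [G.word_lt_iff, G'.word_lt_iff]
    exact (hc q hq _ ((length_wordAdjoint_le w).trans (by lia))).2
  · exact (hc p hp w (by lia)).1
  · exact h p hp q hq w hw

theorem exists_sameCut (h : Agree G G' R Q) (hQ : Q.Finite) (h₀ : (0, 0) ∈ Q) (hk₂ : 2 ≤ k)
    (hk : 4 * (k + 1) + 1 ≤ R) {x : A} (hx : -B.one ≤ x) :
    ∃ x', ∀ q ∈ Q, SameCut G G' k q x x' := by
  let I : Set (List Letter × (A × A')) := {w | w.length ≤ k} ×ˢ Q
  have hI : I.Finite := (List.finite_length_le Letter k).prod hQ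
  by_cases hex : ∃ i ∈ I, G.word i.1 i.2.1 = x
  · obtain ⟨⟨w, p⟩, ⟨hw, hp⟩, rfl⟩ := hex
    exact ⟨G'.word w p.2, fun q hq v hv =>
      ⟨h.word_lt_word_iff hq hp hv hw (by lia), h.word_lt_word_iff hp hq hw hv (by lia)⟩⟩
  · have hne : {i ∈ I | G.word i.1 i.2.1 < x}.Nonempty := by
      refine ⟨([.pred, .pred], (0, 0)), ⟨hk₂, h₀⟩, lt_of_lt_of_le ?_ hx⟩
      change 0 - B.one - B.one < -B.one
      rw [zero_sub]
      exact sub_lt_self _ B.one_pos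
    obtain ⟨⟨w, p⟩, ⟨⟨hw, hp⟩, hlt⟩, hmax⟩ :=
      Set.exists_max_image _ (fun i : List Letter × (A × A') => G.word i.1 i.2.1)
        (hI.subset (Set.sep_subset _ _)) hne
    change w.length ≤ k at hw
    refine ⟨G'.word (.succ :: w) p.2, fun q hq v hv => ?_⟩
    have hcmp : G.word v q.1 < G.word (.succ :: w) p.1 ↔
        G'.word v q.2 < G'.word (.succ :: w) p.2 :=
      h.word_lt_word_iff hq hp (k := k + 1) (by lia) (by simpa using hw) hk
    have hcmp' : G.word (.succ :: w) p.1 < G.word v q.1 ↔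
        G'.word (.succ :: w) p.2 < G'.word v q.2 :=
      h.word_lt_word_iff hp hq (k := k + 1) (by simpa using hw) (by lia) hk
    rcases lt_trichotomy (G.word v q.1) x with hv' | hv' | hv'
    · have := hmax (v, q) ⟨⟨hv, hq⟩, hv'⟩
      have h₁ : G.word v q.1 < G.word (.succ :: w) p.1 := B.le_iff.1 this
      exact ⟨iff_of_true hv' (hcmp.1 h₁),
        iff_of_false hv'.not_gt fun h₂ => h₁.not_gt (hcmp'.2 h₂)⟩
    · exact (hex ⟨(v, q), ⟨hv, hq⟩, hv'⟩).elim
    · have h₁ : G.word (.succ :: w) p.1 < G.word v q.1 :=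
        lt_of_le_of_lt (B.lt_iff.1 hlt) hv'
      exact ⟨iff_of_false hv'.not_gt fun h₂ => h₁.not_gt (hcmp.2 h₂),
        iff_of_true hv' (hcmp'.1 h₁)⟩

end Order

end Shifts

/-- The relation symbols `<` and `step`, both binary. -/
inductive StepRel : ℕ → Type
  | lt : StepRel 2
  | step : StepRel 2

/-- The language with two binary relation symbols. -/
abbrev stepLang : FirstOrder.Language.{0, 0} := ⟨fun _ => Empty, StepRel⟩

instance : HasLt stepLang := ⟨StepRel.lt⟩

instance : stepLang.IsRelational := fun _ => inferInstanceAs (IsEmpty Empty)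

section Points

variable {A A' : Type} [AddCommGroup A] [LinearOrder A] [AddCommGroup A'] [LinearOrder A']

/-- The lexicographic product of the interval from `-one` to `top` and the interval `[0, 1)` of
rational numbers, without its least element. -/
def Pts (B : Base A) : Type :=
  {x : A ×ₗ ℚ // (0 ≤ (ofLex x).2 ∧ (ofLex x).2 < 1) ∧ -B.one ≤ (ofLex x).1 ∧
    (ofLex x).1 ≤ B.top ∧ ((ofLex x).1 = -B.one → 0 < (ofLex x).2)}

noncomputable instance (B : Base A) : LinearOrder (Pts B) :=
  inferInstanceAs (LinearOrder {x : A ×ₗ ℚ // (0 ≤ (ofLex x).2 ∧ (ofLex x).2 < 1) ∧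
    -B.one ≤ (ofLex x).1 ∧ (ofLex x).1 ≤ B.top ∧ ((ofLex x).1 = -B.one → 0 < (ofLex x).2)})

variable {B : Base A} {B' : Base A'}

/-- The integral part of a point. -/
def Pts.floor (x : Pts B) : A := (ofLex x.1).1

/-- The fractional part of a point. -/
def Pts.fract (x : Pts B) : ℚ := (ofLex x.1).2

/-- The point with given integral and fractional parts. -/
def Pts.mk (B : Base A) (d : A) (r : ℚ) (h₀ : 0 ≤ r) (h₁ : r < 1) (hd₀ : -B.one ≤ d)
    (hd₁ : d ≤ B.top) (h : d = -B.one → 0 < r) : Pts B :=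
  ⟨toLex (d, r), ⟨h₀, h₁⟩, hd₀, hd₁, h⟩

@[simp] theorem Pts.floor_mk {d : A} {r : ℚ} (h₀ : 0 ≤ r) (h₁ : r < 1) (hd₀ : -B.one ≤ d)
    (hd₁ : d ≤ B.top) (h : d = -B.one → 0 < r) : (Pts.mk B d r h₀ h₁ hd₀ hd₁ h).floor = d := rfl

@[simp] theorem Pts.fract_mk {d : A} {r : ℚ} (h₀ : 0 ≤ r) (h₁ : r < 1) (hd₀ : -B.one ≤ d)
    (hd₁ : d ≤ B.top) (h : d = -B.one → 0 < r) : (Pts.mk B d r h₀ h₁ hd₀ hd₁ h).fract = r := rfl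

theorem Pts.fract_nonneg (x : Pts B) : 0 ≤ x.fract := x.2.1.1

theorem Pts.fract_lt_one (x : Pts B) : x.fract < 1 := x.2.1.2

theorem Pts.neg_one_le_floor (x : Pts B) : -B.one ≤ x.floor := x.2.2.1

theorem Pts.floor_le_top (x : Pts B) : x.floor ≤ B.top := x.2.2.2.1

theorem Pts.fract_pos (x : Pts B) (h : x.floor = -B.one) : 0 < x.fract := x.2.2.2.2 h

theorem Pts.lt_iff {x y : Pts B} :
    x < y ↔ x.floor < y.floor ∨ x.floor = y.floor ∧ x.fract < y.fract :=
  Prod.Lex.lt_iff (x := x.1) (y := y.1)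

theorem Pts.ext_iff {x y : Pts B} : x = y ↔ x.floor = y.floor ∧ x.fract = y.fract :=
  Subtype.ext_iff.trans (ofLex.injective.eq_iff.symm.trans Prod.ext_iff)

theorem Pts.ext {x y : Pts B} (h : x.floor = y.floor) (h' : x.fract = y.fract) : x = y :=
  Pts.ext_iff.2 ⟨h, h'⟩

/-- The integral points from `0` on and below `top`. -/
def grid (B : Base A) : Set (Pts B) :=
  {x | x.fract = 0 ∧ 0 ≤ x.floor ∧ x.floor < B.top}

/-- The upward map, taken modulo `top`, as a relation on the grid. -/
def Shift.Step (G : Shift B) (x y : Pts B) : Prop :=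
  x ∈ grid B ∧ y ∈ grid B ∧ (y.floor = G.up x.floor ∨ y.floor + B.top = G.up x.floor)

/-- The structure given by the order and the step relation of a shift. -/
@[reducible] def Shift.str (G : Shift B) : stepLang.Structure (Pts B) where
  funMap := fun f _ => Empty.elim f
  RelMap := fun r xs => match r with
    | StepRel.lt => xs 0 < xs 1
    | StepRel.step => G.Step (xs 0) (xs 1)

/-- The pairs of integral parts of a family of pairs of points, together with the pair of zeros. -/
def floorPairs (P : Set (Pts B × Pts B')) : Set (A × A') :=
  insert (0, 0) ((fun p => (p.1.floor, p.2.floor)) '' P)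

theorem mem_floorPairs {P : Set (Pts B × Pts B')} {p : Pts B × Pts B'} (hp : p ∈ P) :
    (p.1.floor, p.2.floor) ∈ floorPairs P :=
  Or.inr ⟨p, hp, rfl⟩

theorem zero_mem_floorPairs (P : Set (Pts B × Pts B')) : (0, 0) ∈ floorPairs P := Or.inl rfl

theorem floorPairs_insert (P : Set (Pts B × Pts B')) (p : Pts B × Pts B') :
    floorPairs (insert p P) = insert (p.1.floor, p.2.floor) (floorPairs P) := by
  rw [floorPairs, Set.image_insert_eq, Set.insert_comm, floorPairs]

theorem floorPairs_swap (P : Set (Pts B × Pts B')) :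
    floorPairs (Prod.swap ⁻¹' P) = Prod.swap ⁻¹' floorPairs P := by
  ext ⟨a, b⟩
  constructor
  · rintro (h | ⟨p, hp, h⟩)
    · cases h
      exact zero_mem_floorPairs P
    · cases h
      exact mem_floorPairs (P := P) (p := p.swap) hp
  · rintro (h | ⟨p, hp, h⟩)
    · cases h
      exact zero_mem_floorPairs _
    · cases h
      exact mem_floorPairs (P := Prod.swap ⁻¹' P) (p := p.swap) (by simpa using hp)

/-- The fractional parts in a family of pairs of points are ordered alike. -/
structure FractAgree (P : Set (Pts B × Pts B')) : Prop where
  lt_iff : ∀ p ∈ P, ∀ q ∈ P, p.1.floor = q.1.floor →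
    (p.1.fract < q.1.fract ↔ p.2.fract < q.2.fract)
  zero_iff : ∀ p ∈ P, p.1.fract = 0 ↔ p.2.fract = 0

/-- The length of the words that are considered when `r` more points have to be matched. -/
def radius : ℕ → ℕ
  | 0 => 3
  | r + 1 => 12 * radius r + 17

theorem radius_le_succ (r : ℕ) : radius r ≤ radius (r + 1) := by
  rw [radius]
  lia

theorem three_le_radius (r : ℕ) : 3 ≤ radius r := by
  cases r with
  | zero => exact le_rfl
  | succ r =>
    rw [radius]
    lia

/-- A finite family of pairs of points of two structures that look alike up to depth `r`. -/
structure Similar (G : Shift B) (G' : Shift B') (r : ℕ) (P : Set (Pts B × Pts B')) : Prop where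
  finite : P.Finite
  agree : Agree G G' (radius r) (floorPairs P)
  fractAgree : FractAgree P

variable {G : Shift B} {G' : Shift B'} {r : ℕ} {P : Set (Pts B × Pts B')}

theorem Similar.anti (h : Similar G G' (r + 1) P) : Similar G G' r P :=
  ⟨h.finite, h.agree.mono (radius_le_succ r), h.fractAgree⟩

section

variable [IsOrderedAddMonoid A] [IsOrderedAddMonoid A']

theorem Agree.eq_word_iff {Q : Set (A × A')} {R : ℕ} (h : Agree G G' R Q) {p q : A × A'}
    (hp : p ∈ Q) (hq : q ∈ Q) {w : List Letter} (hw : w.length + 1 ≤ R) :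
    p.1 = G.word w q.1 ↔ p.2 = G'.word w q.2 := by
  have h₁ := h q hq p hp w (by lia)
  have h₂ := h.lt_word_iff hp hq hw
  rw [le_antisymm_iff, le_antisymm_iff, ← not_lt, ← not_lt, ← not_lt, ← not_lt, h₁, h₂]

theorem Similar.floor_eq_iff (h : Similar G G' r P) {p q : Pts B × Pts B'} (hp : p ∈ P)
    (hq : q ∈ P) : p.1.floor = q.1.floor ↔ p.2.floor = q.2.floor :=
  h.agree.eq_word_iff (mem_floorPairs hp) (mem_floorPairs hq) (w := [])
    (by have := three_le_radius r; simp; lia)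

theorem Similar.lt_iff (h : Similar G G' r P) {p q : Pts B × Pts B'} (hp : p ∈ P)
    (hq : q ∈ P) : p.1 < q.1 ↔ p.2 < q.2 := by
  rw [Pts.lt_iff, Pts.lt_iff, ← h.floor_eq_iff hp hq]
  have h₁ : p.1.floor < q.1.floor ↔ p.2.floor < q.2.floor :=
    h.agree _ (mem_floorPairs hp) _ (mem_floorPairs hq) [] (Nat.zero_le _)
  rw [h₁]
  exact or_congr_right (and_congr_right fun he => h.fractAgree.lt_iff p hp q hq he)

theorem Similar.eq_iff (h : Similar G G' r P) {p q : Pts B × Pts B'} (hp : p ∈ P)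
    (hq : q ∈ P) : p.1 = q.1 ↔ p.2 = q.2 := by
  rw [le_antisymm_iff, le_antisymm_iff, ← not_lt, ← not_lt, ← not_lt, ← not_lt, h.lt_iff hp hq,
    h.lt_iff hq hp]

theorem Similar.mem_grid_iff (h : Similar G G' r P) {p : Pts B × Pts B'} (hp : p ∈ P) :
    p.1 ∈ grid B ↔ p.2 ∈ grid B' := by
  have h₁ := h.fractAgree.zero_iff p hp
  have h₂ := h.agree _ (mem_floorPairs hp) _ (zero_mem_floorPairs P) [] (Nat.zero_le _)
  have h₃ := h.agree.lt_word_iff (mem_floorPairs hp) (zero_mem_floorPairs P) (w := [.next])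
    (by have := three_le_radius r; simp; lia)
  simp only [Shift.word_cons, Shift.word_nil, Shift.act, zero_add] at h₂ h₃
  simp only [grid, Set.mem_ofPred_eq, h₁, ← not_lt, h₂]
  rw [h₃]

theorem Similar.step_iff (h : Similar G G' r P) {p q : Pts B × Pts B'} (hp : p ∈ P)
    (hq : q ∈ P) : G.Step p.1 q.1 ↔ G'.Step p.2 q.2 := by
  have h₁ := h.agree.eq_word_iff (mem_floorPairs hq) (mem_floorPairs hp) (w := [.up])
    (by have := three_le_radius r; simp; lia)
  have h₂ := h.agree.eq_word_iff (mem_floorPairs hq) (mem_floorPairs hp) (w := [.prev, .up])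
    (by have := three_le_radius r; simp; lia)
  simp only [Shift.word_cons, Shift.word_nil, Shift.act, eq_sub_iff_add_eq] at h₁ h₂
  rw [Shift.Step, Shift.Step, h.mem_grid_iff hp, h.mem_grid_iff hq, h₁, h₂]

end

theorem FractAgree.swap (h : FractAgree P)
    (he : ∀ p ∈ P, ∀ q ∈ P, p.1.floor = q.1.floor ↔ p.2.floor = q.2.floor) :
    FractAgree (Prod.swap ⁻¹' P) where
  lt_iff p hp q hq e := (h.lt_iff p.swap hp q.swap hq ((he _ hp _ hq).2 e)).symm
  zero_iff p hp := (h.zero_iff p.swap hp).symm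

theorem exists_fract (hP : P.Finite) (h : FractAgree P) (d : A) (r : ℚ) (h₀ : 0 ≤ r)
    (h₁ : r < 1) : ∃ r' : ℚ, 0 ≤ r' ∧ r' < 1 ∧ (r = 0 ↔ r' = 0) ∧
      ∀ p ∈ P, p.1.floor = d →
        (p.1.fract < r ↔ p.2.fract < r') ∧ (r < p.1.fract ↔ r' < p.2.fract) := by
  rcases h₀.eq_or_lt with rfl | h₀
  · refine ⟨0, le_rfl, h₁, Iff.rfl, fun p hp _ => ⟨?_, ?_⟩⟩
    · exact iff_of_false p.1.fract_nonneg.not_gt p.2.fract_nonneg.not_gt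
    · rw [p.1.fract_nonneg.lt_iff_ne', p.2.fract_nonneg.lt_iff_ne', Ne, h.zero_iff p hp]
  by_cases hex : ∃ p ∈ P, p.1.floor = d ∧ p.1.fract = r
  · obtain ⟨p, hp, rfl, rfl⟩ := hex
    exact ⟨p.2.fract, p.2.fract_nonneg, p.2.fract_lt_one, h.zero_iff p hp, fun q hq e =>
      ⟨h.lt_iff q hq p hp e, h.lt_iff p hp q hq e.symm⟩⟩
  · push Not at hex
    have hlo := (hP.subset (Set.sep_subset P fun p => p.1.floor = d ∧ p.1.fract < r)).image
      fun p => p.2.fract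
    have hhi := (hP.subset (Set.sep_subset P fun p => p.1.floor = d ∧ r < p.1.fract)).image
      fun p => p.2.fract
    obtain ⟨r', hr₁, hr₂⟩ := Order.exists_between_finsets (insert 0 hlo.toFinset)
      (insert 1 hhi.toFinset) (by
        intro a ha b hb
        simp only [Finset.mem_insert, Set.Finite.mem_toFinset] at ha hb
        rcases ha with rfl | ⟨p, ⟨hp, hpd, hpr⟩, rfl⟩ <;>
          rcases hb with rfl | ⟨q, ⟨hq, hqd, hqr⟩, rfl⟩
        · exact one_pos
        · refine q.2.fract_nonneg.lt_of_ne' fun e => ?_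
          rw [← h.zero_iff q hq] at e
          exact (h₀.trans hqr).ne' e
        · exact p.2.fract_lt_one
        · exact (h.lt_iff p hp q hq (hpd.trans hqd.symm)).1 (hpr.trans hqr))
    have h0 := hr₁ 0 (Finset.mem_insert_self _ _)
    refine ⟨r', h0.le, hr₂ 1 (Finset.mem_insert_self _ _), iff_of_false h₀.ne' h0.ne',
      fun p hp e => ?_⟩
    rcases lt_trichotomy p.1.fract r with hlt | heq | hgt
    · have := hr₁ p.2.fract (Finset.mem_insert_of_mem
        (hlo.mem_toFinset.2 ⟨p, ⟨hp, e, hlt⟩, rfl⟩))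
      exact ⟨iff_of_true hlt this, iff_of_false hlt.not_gt this.not_gt⟩
    · exact (hex p hp e heq).elim
    · have := hr₂ p.2.fract (Finset.mem_insert_of_mem
        (hhi.mem_toFinset.2 ⟨p, ⟨hp, e, hgt⟩, rfl⟩))
      exact ⟨iff_of_false hgt.not_gt this.not_gt, iff_of_true hgt this⟩

variable [IsOrderedAddMonoid A] [IsOrderedAddMonoid A']

theorem Similar.swap (h : Similar G G' r P) : Similar G' G r (Prod.swap ⁻¹' P) where
  finite := h.finite.preimage Prod.swap_injective.injOn
  agree := by
    rw [floorPairs_swap]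
    exact h.agree.swap
  fractAgree := h.fractAgree.swap fun _ hp _ hq => h.floor_eq_iff hp hq

/-- Extension of a similarity by a pair of points in the same cut. -/
theorem Similar.insert (h : Similar G G' r P) (hm : MovesAlike G G' (radius r)) {x : Pts B}
    {x' : Pts B'}
    (hc : ∀ q ∈ floorPairs P, SameCut G G' (3 * radius r + 3) q x.floor x'.floor)
    (h₀ : x.fract = 0 ↔ x'.fract = 0)
    (hr : ∀ p ∈ P, p.1.floor = x.floor →
      (p.1.fract < x.fract ↔ p.2.fract < x'.fract) ∧
        (x.fract < p.1.fract ↔ x'.fract < p.2.fract)) :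
    Similar G G' r (insert (x, x') P) where
  finite := h.finite.insert _
  agree := by
    rw [floorPairs_insert]
    exact h.agree.insert hm (zero_mem_floorPairs P) x.neg_one_le_floor x.floor_le_top
      x'.neg_one_le_floor x'.floor_le_top hc
  fractAgree := by
    constructor
    · rintro p (rfl | hp) q (rfl | hq) e
      · simp
      · exact (hr q hq e.symm).2
      · exact (hr p hp e).1
      · exact h.fractAgree.lt_iff p hp q hq e
    · rintro p (rfl | hp)
      · exact h₀
      · exact h.fractAgree.zero_iff p hp

theorem Similar.forth (h : Similar G G' (r + 1) P) (hm : MovesAlike G G' (radius r))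
    (x : Pts B) : ∃ x', Similar G G' r (Insert.insert (x, x') P) := by
  have hrad : radius (r + 1) = 12 * radius r + 17 := rfl
  have hfin : (floorPairs P).Finite := (h.finite.image _).insert _
  obtain ⟨d', hd'⟩ := exists_sameCut h.agree hfin (zero_mem_floorPairs P)
    (k := 3 * radius r + 3) (by lia) (by lia) x.neg_one_le_floor
  obtain ⟨r', h₀, h₁, hz, hr⟩ := exists_fract h.finite h.fractAgree x.floor x.fract
    x.fract_nonneg x.fract_lt_one
  have hpred := hd' _ (zero_mem_floorPairs P) [.pred] (by simp)
  have hnext := hd' _ (zero_mem_floorPairs P) [.next] (by simp)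
  simp only [Shift.word_cons, Shift.word_nil, Shift.act, zero_sub, zero_add] at hpred hnext
  refine ⟨Pts.mk B' d' r' h₀ h₁ (not_lt.1 fun hlt => ?_) (not_lt.1 fun hlt => ?_) fun e => ?_,
    h.anti.insert hm hd' hz hr⟩
  · exact (hpred.2.2 hlt).not_ge x.neg_one_le_floor
  · exact (hnext.1.2 hlt).not_ge x.floor_le_top
  · refine h₀.lt_of_ne' fun e₀ => (x.fract_pos ?_).ne' (hz.2 e₀)
    refine le_antisymm (not_lt.1 fun hlt => ?_) x.neg_one_le_floor
    exact (hpred.1.1 hlt).ne' e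

theorem backForth (n : ℕ) (hm : ∀ r < n, MovesAlike G G' (radius r)) :
    letI := G.str
    letI := G'.str
    BackForth stepLang (Pts B) (Pts B') fun r P => r ≤ n ∧ Similar G G' r P := by
  let := G.str
  let := G'.str
  refine ⟨fun h => ⟨(Nat.le_succ _).trans h.1, h.2.anti⟩,
    fun h p hp q hq => h.2.eq_iff hp hq, ?_, ?_, ?_⟩
  · rintro P ⟨-, h⟩ n (_ | _) xs hxs
    · exact h.lt_iff (hxs 0) (hxs 1)
    · exact h.step_iff (hxs 0) (hxs 1)
  · rintro r P ⟨hr, h⟩ x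
    obtain ⟨x', hx'⟩ := h.forth (hm r hr) x
    exact ⟨x', (Nat.le_succ _).trans hr, hx'⟩
  · rintro r P ⟨hr, h⟩ x'
    obtain ⟨x, hx⟩ := h.swap.forth (hm r hr).swap x'
    refine ⟨x, (Nat.le_succ _).trans hr, ?_⟩
    convert hx.swap using 1
    ext ⟨a, b⟩
    simp [and_comm]

/-- Two structures in which words of bounded length move `0` and all other points alike satisfy
the same sentences of the corresponding depth. -/
theorem models_iff (σ : stepLang.Sentence)
    (h₀ : Agree G G' (radius (quantifierDepth σ)) {(0, 0)})
    (hm : ∀ r < quantifierDepth σ, MovesAlike G G' (radius r)) :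
    (letI := G.str; Pts B ⊨ σ) ↔ (letI := G'.str; Pts B' ⊨ σ) := by
  let := G.str
  let := G'.str
  have := (backForth _ hm).realize_iff σ (fun e => e.elim) Fin.elim0 (P := ∅)
    (fun e => e.elim) (fun i => i.elim0)
    ⟨le_rfl, Set.finite_empty, by simpa [floorPairs] using h₀,
      fun p hp => hp.elim, fun p hp => hp.elim⟩
  simp only [Sentence.Realize, Formula.Realize]
  convert this using 2

end Points

section Definable

variable {L : FirstOrder.Language.{0, 0}} {M : Type} (S : L.Structure M)

theorem union_mem_definableSets {X Y : Set M} (hX : X ∈ definableSets S)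
    (hY : Y ∈ definableSets S) : X ∪ Y ∈ definableSets S :=
  Set.Definable.union hX hY

theorem inter_mem_definableSets {X Y : Set M} (hX : X ∈ definableSets S)
    (hY : Y ∈ definableSets S) : X ∩ Y ∈ definableSets S :=
  Set.Definable.inter hX hY

theorem compl_mem_definableSets {X : Set M} (hX : X ∈ definableSets S) :
    Xᶜ ∈ definableSets S :=
  Set.Definable.compl hX

theorem biUnion_mem_definableSets {ι : Type} {I : Set ι} (hI : I.Finite) {f : ι → Set M}
    (h : ∀ i ∈ I, f i ∈ definableSets S) : (⋃ i ∈ I, f i) ∈ definableSets S := by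
  induction I, hI using Set.Finite.induction_on with
  | empty =>
    rw [Set.biUnion_empty]
    exact Set.definable_empty
  | insert _ _ ih =>
    rw [Set.biUnion_insert]
    exact union_mem_definableSets S (h _ (Set.mem_insert _ _))
      (ih fun i hi => h i (Set.mem_insert_of_mem _ hi))

theorem biInter_mem_definableSets {ι : Type} {I : Set ι} (hI : I.Finite) {f : ι → Set M}
    (h : ∀ i ∈ I, f i ∈ definableSets S) : (⋂ i ∈ I, f i) ∈ definableSets S := by
  have := compl_mem_definableSets S (biUnion_mem_definableSets S hI
    fun i hi => compl_mem_definableSets S (h i hi))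
  simpa only [Set.compl_iUnion, compl_compl] using this

theorem singleton_mem_definableSets (a : M) : {a} ∈ definableSets S := by
  refine (mem_definableSets_iff S _).2
    ⟨1, Term.equal (Term.var (Sum.inr 0)) (Term.var (Sum.inl 0)), fun _ => a, ?_⟩
  ext x
  simp

end Definable

section CutDetermined

variable {M : Type} [LinearOrder M]

/-- The points outside `F` that lie above exactly those points of `F` that belong to `C`. -/
def cutCell (F C : Set M) : Set M :=
  {z | z ∉ F ∧ ∀ f ∈ F, f < z ↔ f ∈ C}

/-- Up to a finite set `F`, the set `X` is a union of intersections of cells of `F` with `D` and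
its complement. -/
def CutDetermined (D X : Set M) : Prop :=
  ∃ F : Set M, F.Finite ∧ ∀ x y, x ∉ F → y ∉ F → (∀ f ∈ F, f < x ↔ f < y) → (x ∈ D ↔ y ∈ D) →
    (x ∈ X ↔ y ∈ X)

theorem eq_union_cutCell {D X F : Set M}
    (h : ∀ x y, x ∉ F → y ∉ F → (∀ f ∈ F, f < x ↔ f < y) → (x ∈ D ↔ y ∈ D) →
      (x ∈ X ↔ y ∈ X)) :
    X = (⋃ a ∈ X ∩ F, {a}) ∪ ((⋃ C ∈ {C | C ⊆ F ∧ cutCell F C ∩ D ⊆ X}, cutCell F C ∩ D) ∪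
      (⋃ C ∈ {C | C ⊆ F ∧ cutCell F C ∩ Dᶜ ⊆ X}, cutCell F C ∩ Dᶜ)) := by
  ext x
  simp only [Set.mem_union, Set.mem_iUnion, Set.mem_singleton_iff, exists_prop]
  constructor
  · intro hx
    by_cases hF : x ∈ F
    · exact Or.inl ⟨x, ⟨hx, hF⟩, rfl⟩
    · have hxc : x ∈ cutCell F {f ∈ F | f < x} :=
        ⟨hF, fun f hf => ⟨fun hlt => ⟨hf, hlt⟩, fun hlt => hlt.2⟩⟩
      have hcell : ∀ y ∈ cutCell F {f ∈ F | f < x}, (x ∈ D ↔ y ∈ D) → y ∈ X := fun y hy hD =>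
        (h x y hF hy.1 (fun f hf => (hxc.2 f hf).trans (hy.2 f hf).symm) hD).1 hx
      by_cases hD : x ∈ D
      · exact Or.inr (Or.inl ⟨_, ⟨Set.sep_subset _ _, fun y hy =>
          hcell y hy.1 (iff_of_true hD hy.2)⟩, hxc, hD⟩)
      · exact Or.inr (Or.inr ⟨_, ⟨Set.sep_subset _ _, fun y hy =>
          hcell y hy.1 (iff_of_false hD hy.2)⟩, hxc, hD⟩)
  · rintro (⟨a, ⟨ha, -⟩, rfl⟩ | ⟨C, ⟨-, hC⟩, hx⟩ | ⟨C, ⟨-, hC⟩, hx⟩)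
    · exact ha
    · exact hC hx
    · exact hC hx

section Definable

variable {L : FirstOrder.Language.{0, 0}} (S : L.Structure M) [HasLt L]

theorem Ioi_mem_definableSets (hlt : ∀ a b : M, ltRel S a b ↔ a < b) (a : M) :
    Set.Ioi a ∈ definableSets S := by
  refine (mem_definableSets_iff S _).2
    ⟨1, Relations.formula₂ (HasLt.ltSymb : L.Relations 2) (Term.var (Sum.inl 0))
      (Term.var (Sum.inr 0)), fun _ => a, ?_⟩
  ext x
  simp only [Set.mem_Ioi, Set.mem_ofPred_eq, Formula.realize_rel₂, Term.realize_var,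
    Sum.elim_inl, Sum.elim_inr]
  exact (hlt a x).symm

theorem mem_definableSets_of_cutDetermined (hlt : ∀ a b : M, ltRel S a b ↔ a < b) {D X : Set M}
    (hD : D ∈ definableSets S) (hX : CutDetermined D X) : X ∈ definableSets S := by
  obtain ⟨F, hF, h⟩ := hX
  have hcell : ∀ C, cutCell F C ∈ definableSets S := by
    intro C
    have heq : cutCell F C = (⋃ a ∈ F, {a})ᶜ ∩
        ⋂ f ∈ F, (Set.Ioi f ∩ {_z | f ∈ C} ∪ (Set.Ioi f)ᶜ ∩ {_z | f ∉ C}) := by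
      ext z
      simp only [cutCell, Set.biUnion_of_singleton, Set.mem_inter_iff, Set.mem_iInter,
        Set.mem_union, Set.mem_compl_iff, Set.mem_Ioi, Set.mem_ofPred_eq]
      exact and_congr_right fun _ => forall₂_congr fun f _ => iff_iff_and_or_not_and_not
    have hconst : ∀ p : Prop, {_z : M | p} ∈ definableSets S := by
      intro p
      by_cases hp : p
      · simp only [hp]
        exact Set.definable_univ
      · simp only [hp]
        exact Set.definable_empty
    rw [heq]
    refine inter_mem_definableSets S (compl_mem_definableSets S
      (biUnion_mem_definableSets S hF fun a _ => singleton_mem_definableSets S a))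
      (biInter_mem_definableSets S hF fun f _ => union_mem_definableSets S
        (inter_mem_definableSets S (Ioi_mem_definableSets S hlt f) (hconst _))
        (inter_mem_definableSets S (compl_mem_definableSets S (Ioi_mem_definableSets S hlt f))
          (hconst _)))
  rw [eq_union_cutCell h]
  refine union_mem_definableSets S (biUnion_mem_definableSets S (hF.subset Set.inter_subset_right)
    fun a _ => singleton_mem_definableSets S a) (union_mem_definableSets S
      (biUnion_mem_definableSets S (hF.finite_subsets.subset fun C hC => hC.1)
        fun C _ => inter_mem_definableSets S (hcell C) hD)
      (biUnion_mem_definableSets S (hF.finite_subsets.subset fun C hC => hC.1)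
        fun C _ => inter_mem_definableSets S (hcell C) (compl_mem_definableSets S hD)))

end Definable

/-- An open interval with endpoints in `M ∪ {-∞, +∞}`. -/
def IsOpenInterval (I : Set M) : Prop :=
  (∃ a b, I = Set.Ioo a b) ∨ (∃ a, I = Set.Ioi a) ∨ (∃ b, I = Set.Iio b) ∨ I = Set.univ

theorem IsOpenInterval.inter_Ioi {I : Set M} (h : IsOpenInterval I) (f : M) :
    IsOpenInterval (I ∩ Set.Ioi f) := by
  rcases h with ⟨a, b, rfl⟩ | ⟨a, rfl⟩ | ⟨b, rfl⟩ | rfl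
  · exact Or.inl ⟨max a f, b, by ext x; simp; tauto⟩
  · exact Or.inr (Or.inl ⟨max a f, Set.Ioi_inter_Ioi⟩)
  · exact Or.inl ⟨f, b, Set.Iio_inter_Ioi⟩
  · exact Or.inr (Or.inl ⟨f, Set.univ_inter _⟩)

theorem IsOpenInterval.inter_Iio {I : Set M} (h : IsOpenInterval I) (f : M) :
    IsOpenInterval (I ∩ Set.Iio f) := by
  rcases h with ⟨a, b, rfl⟩ | ⟨a, rfl⟩ | ⟨b, rfl⟩ | rfl
  · exact Or.inl ⟨a, min b f, by ext x; simp; tauto⟩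
  · exact Or.inl ⟨a, f, Set.Ioi_inter_Iio⟩
  · exact Or.inr (Or.inr (Or.inl ⟨min b f, Set.Iio_inter_Iio⟩))
  · exact Or.inr (Or.inr (Or.inl ⟨f, Set.univ_inter _⟩))

theorem isOpenInterval_cutCell {F : Set M} (hF : F.Finite) (C : Set M) :
    IsOpenInterval (cutCell F C) := by
  induction F, hF using Set.Finite.induction_on with
  | empty => exact Or.inr (Or.inr (Or.inr (by simp [cutCell])))
  | @insert f F _ _ ih =>
    by_cases hC : f ∈ C
    · convert ih.inter_Ioi f using 1
      ext z
      simp only [cutCell, Set.mem_insert_iff, Set.mem_ofPred_eq, forall_eq_or_imp, hC, iff_true,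
        not_or, Set.mem_inter_iff, Set.mem_Ioi]
      exact ⟨fun h => ⟨⟨h.1.2, h.2.2⟩, h.2.1⟩, fun h => ⟨⟨h.2.ne', h.1.1⟩, h.2, h.1.2⟩⟩
    · convert ih.inter_Iio f using 1
      ext z
      simp only [cutCell, Set.mem_insert_iff, Set.mem_ofPred_eq, forall_eq_or_imp, hC, iff_false,
        not_or, Set.mem_inter_iff, Set.mem_Iio, not_lt]
      exact ⟨fun h => ⟨⟨h.1.2, h.2.2⟩, h.2.1.lt_of_ne h.1.1⟩,
        fun h => ⟨⟨h.2.ne, h.1.1⟩, h.2.le, h.1.2⟩⟩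

/-- A set that is determined by cuts, up to the elements of a finite set, is a finite union of
points and intervals. -/
theorem CutDetermined.exists_sUnion {D X : Set M} (hD : D.Finite) (hX : CutDetermined D X) :
    ∃ F : Set (Set M), F.Finite ∧ (∀ I ∈ F, IsPointOrInterval I) ∧ X = ⋃₀ F := by
  obtain ⟨F, hF, h⟩ := hX
  have h' : ∀ x y, x ∉ F ∪ D → y ∉ F ∪ D → (∀ f ∈ F ∪ D, f < x ↔ f < y) →
      (x ∈ (∅ : Set M) ↔ y ∈ (∅ : Set M)) → (x ∈ X ↔ y ∈ X) := fun x y hx hy hlt _ =>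
    h x y (fun hx' => hx (Or.inl hx')) (fun hy' => hy (Or.inl hy'))
      (fun f hf => hlt f (Or.inl hf))
      (iff_of_false (fun hx' => hx (Or.inr hx')) (fun hy' => hy (Or.inr hy')))
  have hFD := hF.union hD
  refine ⟨(fun a => {a}) '' (X ∩ (F ∪ D)) ∪ cutCell (F ∪ D) ''
    {C | C ⊆ F ∪ D ∧ cutCell (F ∪ D) C ∩ ∅ᶜ ⊆ X},
    ((hFD.subset Set.inter_subset_right).image _).union
      ((hFD.finite_subsets.subset fun C hC => hC.1).image _), ?_, ?_⟩
  · rintro _ (⟨a, -, rfl⟩ | ⟨C, -, rfl⟩)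
    · exact Or.inl ⟨a, rfl⟩
    · exact Or.inr (isOpenInterval_cutCell hFD C)
  · have heq := eq_union_cutCell h'
    rw [Set.sUnion_union, Set.sUnion_image, Set.sUnion_image]
    simpa using heq

end CutDetermined

section Points

variable {A : Type} [AddCommGroup A] [LinearOrder A] {B : Base A}

theorem agree_of_diagonal (G : Shift B) (R : ℕ) {Q : Set (A × A)} (h : ∀ p ∈ Q, p.1 = p.2) :
    Agree G G R Q := by
  intro p hp q hq w _
  rw [h p hp, h q hq]

theorem domain_mem_definableSets {M : Type} (S : stepLang.Structure M) :
    {x | ∃ y, S.RelMap StepRel.step ![x, y]} ∈ definableSets S := by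
  refine (mem_definableSets_iff S _).2 ⟨0,
    (Relations.boundedFormula₂ (StepRel.step : stepLang.Relations 2)
      (Term.var (Sum.inl (Sum.inr 0))) (Term.var (Sum.inr 0)) :
        stepLang.BoundedFormula (Fin 0 ⊕ Fin 1) 1).ex, Fin.elim0, ?_⟩
  ext x
  simp only [Set.mem_ofPred_eq, Formula.Realize, BoundedFormula.realize_ex,
    BoundedFormula.realize_rel₂]
  rfl

theorem grid_mem_definableSets (G : Shift B) (htot : ∀ x ∈ grid B, ∃ y, G.Step x y) :
    grid B ∈ definableSets G.str := by
  convert domain_mem_definableSets G.str using 1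
  ext x
  exact ⟨htot x, fun ⟨y, hy⟩ => hy.1⟩

variable [IsOrderedAddMonoid A]

theorem Pts.mem_grid_iff {x : Pts B} (h : x.floor ≠ B.top) : x ∈ grid B ↔ x.fract = 0 := by
  refine ⟨fun hx => hx.1, fun hx => ⟨hx, ?_, x.floor_le_top.lt_of_ne h⟩⟩
  have hlt : -B.one < x.floor := x.neg_one_le_floor.lt_of_ne fun e => (x.fract_pos e.symm).ne' hx
  rwa [B.lt_iff, neg_add_cancel] at hlt

theorem expandsDLO (G : Shift B) : ExpandsDLO G.str where
  nonempty := ⟨Pts.mk B 0 0 le_rfl one_pos (neg_nonpos.2 B.one_pos.le) B.top_pos.le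
    fun h => (B.one_pos.ne' (neg_eq_zero.1 h.symm)).elim⟩
  dense := by
    refine ⟨fun x y hxy => ?_⟩
    have h₀ := x.fract_nonneg
    have h₁ := x.fract_lt_one
    rcases Pts.lt_iff.1 hxy with h | ⟨h, h'⟩
    · refine ⟨Pts.mk B x.floor ((x.fract + 1) / 2) (by linarith) (by linarith)
        x.neg_one_le_floor x.floor_le_top fun _ => by linarith, ?_, ?_⟩
      · exact Pts.lt_iff.2 (Or.inr ⟨rfl, by rw [Pts.fract_mk]; linarith⟩)
      · exact Pts.lt_iff.2 (Or.inl h)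
    · have h₂ := y.fract_lt_one
      refine ⟨Pts.mk B x.floor ((x.fract + y.fract) / 2) (by linarith) (by linarith)
        x.neg_one_le_floor x.floor_le_top fun _ => by linarith, ?_, ?_⟩
      · exact Pts.lt_iff.2 (Or.inr ⟨rfl, by rw [Pts.fract_mk]; linarith⟩)
      · exact Pts.lt_iff.2 (Or.inr ⟨h, by rw [Pts.fract_mk]; linarith⟩)
  noMin := by
    refine ⟨fun x => ?_⟩
    have h₁ := x.fract_lt_one
    rcases x.fract_nonneg.eq_or_lt with h₀ | h₀
    · have hlt : -B.one < x.floor :=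
        x.neg_one_le_floor.lt_of_ne fun e => (x.fract_pos e.symm).ne h₀
      refine ⟨Pts.mk B (x.floor - B.one) (1 / 2) (by norm_num) (by norm_num) ?_ ?_
        fun _ => by norm_num, Pts.lt_iff.2 (Or.inl (sub_lt_self _ B.one_pos))⟩
      · rw [B.lt_iff, neg_add_cancel] at hlt
        rwa [le_sub_iff_add_le, neg_add_cancel]
      · exact (sub_le_self _ B.one_pos.le).trans x.floor_le_top
    · exact ⟨Pts.mk B x.floor (x.fract / 2) (by linarith) (by linarith) x.neg_one_le_floor
        x.floor_le_top fun _ => by linarith,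
        Pts.lt_iff.2 (Or.inr ⟨rfl, by rw [Pts.fract_mk]; linarith⟩)⟩
  noMax := by
    refine ⟨fun x => ?_⟩
    have h₀ := x.fract_nonneg
    have h₁ := x.fract_lt_one
    exact ⟨Pts.mk B x.floor ((x.fract + 1) / 2) (by linarith) (by linarith) x.neg_one_le_floor
      x.floor_le_top fun _ => by linarith,
      Pts.lt_iff.2 (Or.inr ⟨rfl, by rw [Pts.fract_mk]; linarith⟩)⟩
  lt_iff _ _ := Iff.rfl

theorem cutDetermined_of_mem_definableSets (G : Shift B) (hm : ∀ R, MovesAlike G G R)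
    {X : Set (Pts B)} (hX : X ∈ definableSets G.str) : CutDetermined (grid B) X := by
  let := G.str
  obtain ⟨k, φ, ys, rfl⟩ := (mem_definableSets_iff G.str X).1 hX
  let r := quantifierDepth φ
  let P : Set (Pts B × Pts B) := Set.range fun i => (ys i, ys i)
  have hPfin : P.Finite := Set.finite_range _
  have hPd : ∀ p ∈ P, p.1 = p.2 := by
    rintro _ ⟨i, rfl⟩
    rfl
  have hQd : ∀ q ∈ floorPairs P, q.1 = q.2 := by
    rintro _ (rfl | ⟨p, hp, rfl⟩)
    · rfl
    · exact congrArg Pts.floor (hPd p hp)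
  have hP : Similar G G r P := by
    refine ⟨hPfin, agree_of_diagonal G _ hQd, ⟨fun p hp q hq _ => ?_, fun p hp => ?_⟩⟩
    · rw [hPd p hp, hPd q hq]
    · rw [hPd p hp]
  let V : Set A := (fun i : List Letter × (A × A) => G.word i.1 i.2.1) ''
    ({w | w.length ≤ 3 * radius r + 4} ×ˢ floorPairs P)
  have hV : V.Finite :=
    ((List.finite_length_le Letter _).prod ((hPfin.image _).insert _)).image _
  have hmemV : ∀ q ∈ floorPairs P, ∀ w : List Letter, w.length ≤ 3 * radius r + 4 →
      G.word w q.1 ∈ V := fun q hq w hw => ⟨(w, q), ⟨hw, hq⟩, rfl⟩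
  have hgrid : {z : Pts B | z.fract = 0 ∧ z.floor ∈ V}.Finite :=
    Set.Finite.of_finite_image (f := Pts.floor)
      (hV.subset (Set.image_subset_iff.2 fun z hz => hz.2))
      fun x hx y hy e => Pts.ext e (hx.1.trans hy.1.symm)
  refine ⟨Set.range ys ∪ {z | z.fract = 0 ∧ z.floor ∈ V}, (Set.finite_range _).union hgrid,
    fun x y hx hy hlt hD => ?_⟩
  have hle : ∀ v ∈ V, v ≤ x.floor ↔ v ≤ y.floor := by
    intro v hv
    rcases le_or_gt v (-B.one) with h₁ | h₁
    · exact iff_of_true (h₁.trans x.neg_one_le_floor) (h₁.trans y.neg_one_le_floor)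
    rcases lt_or_ge B.top v with h₂ | h₂
    · exact iff_of_false (x.floor_le_top.trans_lt h₂).not_ge (y.floor_le_top.trans_lt h₂).not_ge
    let z : Pts B := Pts.mk B v 0 le_rfl one_pos h₁.le h₂ fun e => (h₁.ne' e).elim
    have hz : z ∈ Set.range ys ∪ {z | z.fract = 0 ∧ z.floor ∈ V} := Or.inr ⟨rfl, hv⟩
    have key : ∀ u : Pts B, u ∉ Set.range ys ∪ {z | z.fract = 0 ∧ z.floor ∈ V} →
        (v ≤ u.floor ↔ z < u) := by
      intro u hu
      have hne : v = u.floor → 0 < u.fract := fun e =>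
        u.fract_nonneg.lt_of_ne fun e' => hu (Or.inr ⟨e'.symm, e ▸ hv⟩)
      rw [Pts.lt_iff]
      change _ ↔ v < u.floor ∨ v = u.floor ∧ 0 < u.fract
      rw [le_iff_lt_or_eq]
      exact or_congr_right ⟨fun e => ⟨e, hne e⟩, fun e => e.1⟩
    rw [key x hx, key y hy]
    exact hlt z hz
  have hcut : ∀ q ∈ floorPairs P, SameCut G G (3 * radius r + 3) q x.floor y.floor := by
    intro q hq w hw
    rw [← hQd q hq]
    have h₁ := hle _ (hmemV q hq (.succ :: w) (by simpa using hw))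
    have h₂ := hle _ (hmemV q hq w (by lia))
    rw [B.lt_iff, B.lt_iff, ← not_le, ← not_le (b := y.floor)]
    exact ⟨h₁, not_congr h₂⟩
  have htop : ∀ u : Pts B, u ∉ Set.range ys ∪ {z | z.fract = 0 ∧ z.floor ∈ V} →
      (u ∈ grid B ↔ u.fract = 0) := by
    intro u hu
    by_cases h : u.floor = B.top
    · refine iff_of_false (fun hu' => hu'.2.2.ne h) fun hu' => hu (Or.inr ⟨hu', ?_⟩)
      have := hmemV _ (zero_mem_floorPairs P) [.next] (by simp)
      simp only [Shift.word_cons, Shift.word_nil, Shift.act, zero_add] at this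
      exact h ▸ this
    · exact Pts.mem_grid_iff h
  rw [htop x hx, htop y hy] at hD
  have hfr : ∀ p ∈ P, p.1.floor = x.floor →
      (p.1.fract < x.fract ↔ p.2.fract < y.fract) ∧
        (x.fract < p.1.fract ↔ y.fract < p.2.fract) := by
    rintro _ ⟨i, rfl⟩ e
    change (ys i).floor = x.floor at e
    have hc : ((ys i).floor < x.floor ↔ (ys i).floor < y.floor) ∧
        (x.floor < (ys i).floor ↔ y.floor < (ys i).floor) :=
      hcut _ (mem_floorPairs (P := P) ⟨i, rfl⟩) [] (Nat.zero_le _)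
    have e' : (ys i).floor = y.floor :=
      le_antisymm (not_lt.1 fun h => e.le.not_gt (hc.2.2 h))
        (not_lt.1 fun h => e.ge.not_gt (hc.1.2 h))
    have hx' : ys i ≠ x := fun h => hx (Or.inl ⟨i, h⟩)
    have hy' : ys i ≠ y := fun h => hy (Or.inl ⟨i, h⟩)
    have h₁ : (ys i).fract < x.fract ↔ ys i < x := by simp [Pts.lt_iff, e]
    have h₂ : (ys i).fract < y.fract ↔ ys i < y := by simp [Pts.lt_iff, e']
    have h₃ : x.fract < (ys i).fract ↔ x < ys i := by simp [Pts.lt_iff, e]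
    have h₄ : y.fract < (ys i).fract ↔ y < ys i := by simp [Pts.lt_iff, e']
    have h₅ := hlt (ys i) (Or.inl ⟨i, rfl⟩)
    refine ⟨h₁.trans (h₅.trans h₂.symm), ?_⟩
    change x.fract < (ys i).fract ↔ y.fract < (ys i).fract
    rw [h₃, h₄, lt_iff_not_ge, lt_iff_not_ge, hx'.le_iff_lt, hy'.le_iff_lt, h₅]
  have hsim := hP.insert (hm _) hcut hD hfr
  have := (backForth r fun s _ => hm (radius s)).realize_iff φ
    (Sum.elim (fun i => (ys i, ys i)) fun _ => (x, y)) Fin.elim0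
    (by
      rintro (i | i)
      · exact Or.inr ⟨i, rfl⟩
      · exact Or.inl rfl) (fun i => i.elim0) ⟨le_rfl, hsim⟩
  have e₁ : (fun i => (Sum.elim (fun i => (ys i, ys i)) (fun _ => (x, y)) i).1) =
      (Sum.elim ys fun _ => x : Fin k ⊕ Fin 1 → Pts B) := by
    funext i
    rcases i with i | i <;> rfl
  have e₂ : (fun i => (Sum.elim (fun i => (ys i, ys i)) (fun _ => (x, y)) i).2) =
      (Sum.elim ys fun _ => y : Fin k ⊕ Fin 1 → Pts B) := by
    funext i
    rcases i with i | i <;> rfl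
  rw [e₁, e₂] at this
  simp only [Set.mem_ofPred_eq, Formula.Realize]
  convert this using 2

theorem definableSets_eq (G : Shift B) (hm : ∀ R, MovesAlike G G R)
    (htot : ∀ x ∈ grid B, ∃ y, G.Step x y) :
    definableSets G.str = {X | CutDetermined (grid B) X} :=
  Set.Subset.antisymm (fun _ hX => cutDetermined_of_mem_definableSets G hm hX) fun _ hX =>
    mem_definableSets_of_cutDetermined G.str (expandsDLO G).lt_iff
      (grid_mem_definableSets G htot) hX

theorem isOMinimal_of_finite_grid (G : Shift B) (hm : ∀ R, MovesAlike G G R)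
    (hfin : (grid B).Finite) : IsOMinimal G.str where
  toExpandsDLO := expandsDLO G
  omin _ hX := (cutDetermined_of_mem_definableSets G hm hX).exists_sUnion hfin

end Points

/-- The numbers of steps by `top`, by the shift and by `one` that a letter makes. -/
def letterExp : Letter → ℤ × ℤ × ℤ
  | .succ => (0, 0, 1)
  | .pred => (0, 0, -1)
  | .next => (1, 0, 0)
  | .prev => (-1, 0, 0)
  | .up => (0, 1, 0)
  | .down => (0, -1, 0)

/-- The numbers of steps by `top`, by the shift and by `one` that a word makes. -/
def wordExp (w : List Letter) : ℤ × ℤ × ℤ := (w.map letterExp).sum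

@[simp] theorem wordExp_nil : wordExp [] = 0 := rfl

@[simp] theorem wordExp_cons (l : Letter) (w : List Letter) :
    wordExp (l :: w) = letterExp l + wordExp w := by
  simp [wordExp]

theorem wordExp_bound (w : List Letter) :
    (-w.length ≤ (wordExp w).1 ∧ (wordExp w).1 ≤ w.length) ∧
      (-w.length ≤ (wordExp w).2.1 ∧ (wordExp w).2.1 ≤ w.length) ∧
      (-w.length ≤ (wordExp w).2.2 ∧ (wordExp w).2.2 ≤ w.length) := by
  induction w with
  | nil => simp
  | cons l w ih =>
    cases l <;> simp [letterExp] <;> lia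

section Flat

variable {A A' : Type} [AddCommGroup A] [LinearOrder A] [IsOrderedAddMonoid A]
  [AddCommGroup A'] [LinearOrder A'] [IsOrderedAddMonoid A'] {B : Base A} {B' : Base A'}

/-- The translation by `a`. -/
def flatShift (B : Base A) (a : A) : Shift B where
  up x := x + a
  down x := x - a
  gc _ _ := sub_le_iff_le_add

/-- The element by which a word translates. -/
def wordValue (B : Base A) (a : A) (w : List Letter) : A :=
  (wordExp w).1 • B.top + (wordExp w).2.1 • a + (wordExp w).2.2 • B.one

theorem word_flatShift (a : A) (w : List Letter) (x : A) :
    (flatShift B a).word w x = x + wordValue B a w := by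
  induction w with
  | nil => simp [wordValue]
  | cons l w ih =>
    rw [Shift.word_cons, ih]
    cases l <;> simp only [Shift.act, flatShift, wordValue, wordExp_cons, letterExp,
      Prod.fst_add, Prod.snd_add, add_smul, zero_smul, one_smul, neg_smul] <;> abel

theorem word_flatShift_lt_iff (a : A) (w : List Letter) (x : A) :
    (flatShift B a).word w x < x ↔ wordValue B a w < 0 := by
  rw [word_flatShift, add_lt_iff_neg_left]

theorem movesAlike_flatShift {a : A} {a' : A'} {R : ℕ}
    (h : ∀ w : List Letter, w.length ≤ R → (wordValue B a w < 0 ↔ wordValue B' a' w < 0)) :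
    MovesAlike (flatShift B a) (flatShift B' a') R := by
  intro x x' _ _ _ _ _ w hw
  rw [word_flatShift_lt_iff, word_flatShift_lt_iff, h w hw]

theorem agree_flatShift {a : A} {a' : A'} {R : ℕ}
    (h : ∀ w : List Letter, w.length ≤ R → (wordValue B a w < 0 ↔ wordValue B' a' w < 0)) :
    Agree (flatShift B a) (flatShift B' a') R {(0, 0)} := by
  rintro _ rfl _ rfl w hw
  rw [word_flatShift_lt_iff, word_flatShift_lt_iff, h w hw]

end Flat

/-- The base for the integers with top element `n`. -/
def intBase (n : ℤ) (hn : 0 < n) : Base ℤ where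
  one := 1
  top := n
  one_pos := one_pos
  one_le _ h := h
  top_pos := hn

theorem finite_grid_intBase (n : ℤ) (hn : 0 < n) : (grid (intBase n hn)).Finite :=
  Set.Finite.of_finite_image (f := Pts.floor)
    ((Set.finite_Ico (0 : ℤ) n).subset (Set.image_subset_iff.2 fun _ hx => hx.2))
    fun _ hx _ hy e => Pts.ext e (hx.1.trans hy.1.symm)

/-- Triples of integers, ordered lexicographically. -/
abbrev Triple : Type := ℤ ×ₗ ℤ ×ₗ ℤ

/-- The triple with the given entries. -/
def tri (a b c : ℤ) : Triple := toLex (a, toLex (b, c))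

theorem exists_tri (x : Triple) : ∃ a b c, x = tri a b c := ⟨_, _, _, rfl⟩

theorem tri_lt {a b c a' b' c' : ℤ} :
    tri a b c < tri a' b' c' ↔ a < a' ∨ a = a' ∧ (b < b' ∨ b = b' ∧ c < c') := by
  rw [tri, tri, Prod.Lex.toLex_lt_toLex, Prod.Lex.toLex_lt_toLex]

theorem tri_le {a b c a' b' c' : ℤ} :
    tri a b c ≤ tri a' b' c' ↔ a < a' ∨ a = a' ∧ (b < b' ∨ b = b' ∧ c ≤ c') := by
  rw [tri, tri, Prod.Lex.toLex_le_toLex, Prod.Lex.toLex_le_toLex]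

theorem tri_inj {a b c a' b' c' : ℤ} :
    tri a b c = tri a' b' c' ↔ a = a' ∧ b = b' ∧ c = c' := by
  simp [tri]

theorem tri_add (a b c a' b' c' : ℤ) :
    tri a b c + tri a' b' c' = tri (a + a') (b + b') (c + c') := rfl

theorem tri_sub (a b c a' b' c' : ℤ) :
    tri a b c - tri a' b' c' = tri (a - a') (b - b') (c - c') := rfl

theorem neg_tri (a b c : ℤ) : -tri a b c = tri (-a) (-b) (-c) := rfl

theorem zero_eq_tri : (0 : Triple) = tri 0 0 0 := rfl

theorem smul_tri (n a b c : ℤ) : n • tri a b c = tri (n * a) (n * b) (n * c) := rfl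

/-- The base for the triples of integers. -/
def tripleBase : Base Triple where
  one := tri 0 0 1
  top := tri 1 0 0
  one_pos := by rw [zero_eq_tri, tri_lt]; lia
  one_le x h := by
    obtain ⟨a, b, c, rfl⟩ := exists_tri x
    rw [zero_eq_tri, tri_lt] at h
    rw [tri_le]
    lia
  top_pos := by rw [zero_eq_tri, tri_lt]; lia

/-- The flat shift on triples. -/
def flatTriple : Shift tripleBase := flatShift tripleBase (tri 0 1 0)

/-- The shift on triples that agrees with the flat one, except that it omits the triples
`(a, 0, 0)`. -/
def curvedTriple : Shift tripleBase where
  up x := tri (ofLex x).1 ((ofLex (ofLex x).2).1 + 1)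
    (if (ofLex (ofLex x).2).1 = -1 ∧ 0 ≤ (ofLex (ofLex x).2).2 then (ofLex (ofLex x).2).2 + 1
      else (ofLex (ofLex x).2).2)
  down x := tri (ofLex x).1 ((ofLex (ofLex x).2).1 - 1)
    (if (ofLex (ofLex x).2).1 = 0 ∧ 0 < (ofLex (ofLex x).2).2 then (ofLex (ofLex x).2).2 - 1
      else (ofLex (ofLex x).2).2)
  gc x y := by
    obtain ⟨a, b, c, rfl⟩ := exists_tri x
    obtain ⟨a', b', c', rfl⟩ := exists_tri y
    simp only [tri, Prod.Lex.toLex_le_toLex, ofLex_toLex]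
    split_ifs <;> lia

theorem curvedTriple_up (a b c : ℤ) : curvedTriple.up (tri a b c) =
    tri a (b + 1) (if b = -1 ∧ 0 ≤ c then c + 1 else c) := rfl

theorem curvedTriple_down (a b c : ℤ) : curvedTriple.down (tri a b c) =
    tri a (b - 1) (if b = 0 ∧ 0 < c then c - 1 else c) := rfl

theorem wordValue_triple (w : List Letter) : wordValue tripleBase (tri 0 1 0) w =
    tri (wordExp w).1 (wordExp w).2.1 (wordExp w).2.2 := by
  change _ • tri 1 0 0 + _ • tri 0 1 0 + _ • tri 0 0 1 = _
  simp only [smul_tri, tri_add, mul_zero, mul_one, add_zero, zero_add]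

/-- A combination with coefficients of absolute value at most `R` of `(R + 1) ^ 2`, `R + 1` and `1`
is negative just when the coefficients are lexicographically negative. -/
theorem combination_neg_iff {R i k j : ℤ} (hi : -R ≤ i ∧ i ≤ R) (hk : -R ≤ k ∧ k ≤ R)
    (hj : -R ≤ j ∧ j ≤ R) :
    i * (R + 1) ^ 2 + k * (R + 1) + j < 0 ↔ i < 0 ∨ i = 0 ∧ (k < 0 ∨ k = 0 ∧ j < 0) := by
  have hR : 0 ≤ R := by lia
  have key : ∀ {m : ℤ}, -R ≤ m ∧ m ≤ R → ∀ l, (m < 0 → m * (R + 1) + l ≤ -(R + 1) + l) ∧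
      (0 < m → R + 1 + l ≤ m * (R + 1) + l) := by
    intro m _ l
    constructor <;> intro h <;> nlinarith
  have h₁ : -(R * (R + 1)) ≤ k * (R + 1) ∧ k * (R + 1) ≤ R * (R + 1) := by
    constructor <;> nlinarith
  have h₂ : i < 0 → i * (R + 1) ^ 2 ≤ -(R + 1) ^ 2 := fun h => by nlinarith [sq_nonneg (R + 1)]
  have h₃ : 0 < i → (R + 1) ^ 2 ≤ i * (R + 1) ^ 2 := fun h => by nlinarith [sq_nonneg (R + 1)]
  rcases lt_trichotomy i 0 with h | h | h
  · refine iff_of_true ?_ (Or.inl h)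
    nlinarith [h₂ h]
  · subst h
    obtain ⟨h₄, h₅⟩ := key hk j
    rcases lt_trichotomy k 0 with h | h | h
    · have := h₄ h
      exact iff_of_true (by lia) (by lia)
    · subst h
      simp
    · have := h₅ h
      exact iff_of_false (by lia) (by lia)
  · refine iff_of_false ?_ (by lia)
    nlinarith [h₃ h]

theorem wordValue_triple_neg_iff {R : ℕ} {w : List Letter} (hw : w.length ≤ R)
    (hn : 0 < ((R : ℤ) + 1) ^ 2) :
    wordValue tripleBase (tri 0 1 0) w < 0 ↔
      wordValue (intBase (((R : ℤ) + 1) ^ 2) hn) ((R : ℤ) + 1) w < 0 := by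
  obtain ⟨hi, hk, hj⟩ := wordExp_bound w
  rw [wordValue_triple, zero_eq_tri, tri_lt]
  have := combination_neg_iff (R := R) (i := (wordExp w).1) (k := (wordExp w).2.1)
    (j := (wordExp w).2.2) (by lia) (by lia) (by lia)
  rw [← this]
  simp only [wordValue, intBase, smul_eq_mul, mul_one]

theorem radius_mono {r s : ℕ} (h : r ≤ s) : radius r ≤ radius s :=
  monotone_nat_of_le_succ radius_le_succ h

theorem isPseudoOMinimal_flatTriple : IsPseudoOMinimal flatTriple.str := by
  let := flatTriple.str
  refine (Theory.model_iff _).2 fun σ hσ => ?_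
  have hn : 0 < ((radius (quantifierDepth σ) : ℤ) + 1) ^ 2 := by positivity
  have key := fun {w : List Letter} (hw : w.length ≤ radius (quantifierDepth σ)) =>
    wordValue_triple_neg_iff hw hn
  refine (models_iff σ (agree_flatShift fun w hw => key hw) fun r hr =>
    movesAlike_flatShift fun w hw => key (hw.trans (radius_mono hr.le))).2 ?_
  exact hσ _ inferInstance _ (isOMinimal_of_finite_grid _
    (fun R => movesAlike_flatShift fun _ _ => Iff.rfl) (finite_grid_intBase _ hn))

section Curved

/-- The characteristic function of the nonnegative integers. -/
def nonnegInd (b : ℤ) : ℤ := if 0 ≤ b then 1 else 0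

theorem word_curvedTriple_of_lt {R : ℕ} {a b c : ℤ} (hc : R < c) (w : List Letter)
    (hw : w.length ≤ R) :
    curvedTriple.word w (tri a b c) = tri (a + (wordExp w).1) (b + (wordExp w).2.1)
        (c + ((wordExp w).2.2 + nonnegInd (b + (wordExp w).2.1) - nonnegInd b)) ∧
      -(w.length : ℤ) ≤ (wordExp w).2.2 + nonnegInd (b + (wordExp w).2.1) - nonnegInd b := by
  induction w with
  | nil => simp
  | cons l w ih =>
    rw [List.length_cons] at hw
    obtain ⟨ih₁, ih₂⟩ := ih (by lia)
    rw [Shift.word_cons, ih₁]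
    cases l <;> simp only [Shift.act, curvedTriple_up, curvedTriple_down, tripleBase, tri_add,
      tri_sub, tri_inj, wordExp_cons, letterExp, Prod.fst_add, Prod.snd_add, List.length_cons,
      Nat.cast_add, Nat.cast_one, nonnegInd] at ih₂ ⊢ <;> grind

theorem word_curvedTriple_of_lt_neg {R : ℕ} {a b c : ℤ} (hc : c < -R) (w : List Letter)
    (hw : w.length ≤ R) :
    curvedTriple.word w (tri a b c) = tri (a + (wordExp w).1) (b + (wordExp w).2.1)
      (c + (wordExp w).2.2) := by
  induction w with
  | nil => simp
  | cons l w ih =>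
    rw [List.length_cons] at hw
    have := wordExp_bound w
    rw [Shift.word_cons, ih (by lia)]
    cases l <;> simp only [Shift.act, curvedTriple_up, curvedTriple_down, tripleBase, tri_add,
      tri_sub, tri_inj, wordExp_cons, letterExp, Prod.fst_add, Prod.snd_add] <;> grind

theorem word_curvedTriple_of_lt_abs {R : ℕ} {a b c : ℤ} (hb : R < b ∨ b < -R) (w : List Letter)
    (hw : w.length ≤ R) :
    curvedTriple.word w (tri a b c) = tri (a + (wordExp w).1) (b + (wordExp w).2.1)
      (c + (wordExp w).2.2) := by
  induction w with
  | nil => simp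
  | cons l w ih =>
    rw [List.length_cons] at hw
    have := wordExp_bound w
    rw [Shift.word_cons, ih (by lia)]
    cases l <;> simp only [Shift.act, curvedTriple_up, curvedTriple_down, tripleBase, tri_add,
      tri_sub, tri_inj, wordExp_cons, letterExp, Prod.fst_add, Prod.snd_add] <;> grind

/-- Away from the omitted triples, short words act as for the flat shift, apart from the last entry
of triples that they move between rows. -/
theorem word_curvedTriple_lt_iff {R : ℕ} {a b c : ℤ}
    (h : (R < b ∨ b < -R) ∨ R < c ∨ c < -R) {w : List Letter} (hw : w.length ≤ R) :
    curvedTriple.word w (tri a b c) < tri a b c ↔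
      tri (wordExp w).1 (wordExp w).2.1 (wordExp w).2.2 < tri 0 0 0 := by
  rcases h with h | h | h
  · rw [word_curvedTriple_of_lt_abs h w hw, tri_lt, tri_lt]
    lia
  · rw [(word_curvedTriple_of_lt h w hw).1, tri_lt, tri_lt]
    by_cases hk : (wordExp w).2.1 = 0
    · simp only [hk, add_zero]
      lia
    · lia
  · rw [word_curvedTriple_of_lt_neg h w hw, tri_lt, tri_lt]
    lia

theorem exists_word_curvedTriple {R : ℕ} {a b c : ℤ} (ha : a = 0 ∨ a = 1)
    (hb : -R ≤ b ∧ b ≤ R) (hc : -R ≤ c ∧ c ≤ R) :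
    ∃ w : List Letter, w.length ≤ 2 * R + 1 ∧ curvedTriple.word w 0 = tri a b c := by
  have hup : ∀ n : ℕ, curvedTriple.word (List.replicate n .up) 0 = tri 0 n 0 := by
    intro n
    induction n with
    | zero => rfl
    | succ n ih =>
      rw [List.replicate_succ, Shift.word_cons, ih, Shift.act, curvedTriple_up, tri_inj]
      split_ifs <;> lia
  have hdown : ∀ n : ℕ, curvedTriple.word (List.replicate n .down) 0 = tri 0 (-n) 0 := by
    intro n
    induction n with
    | zero => rfl
    | succ n ih =>
      rw [List.replicate_succ, Shift.word_cons, ih, Shift.act, curvedTriple_down, tri_inj]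
      split_ifs <;> lia
  have hsucc : ∀ (n : ℕ) (a b c : ℤ),
      curvedTriple.word (List.replicate n .succ) (tri a b c) = tri a b (c + n) := by
    intro n a b c
    induction n with
    | zero => simp
    | succ n ih =>
      rw [List.replicate_succ, Shift.word_cons, ih, Shift.act]
      change tri a b _ + tri 0 0 1 = _
      rw [tri_add, tri_inj]
      lia
  have hpred : ∀ (n : ℕ) (a b c : ℤ),
      curvedTriple.word (List.replicate n .pred) (tri a b c) = tri a b (c - n) := by
    intro n a b c
    induction n with
    | zero => simp
    | succ n ih =>
      rw [List.replicate_succ, Shift.word_cons, ih, Shift.act]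
      change tri a b _ - tri 0 0 1 = _
      rw [tri_sub, tri_inj]
      lia
  obtain ⟨u, hu, hu'⟩ : ∃ u : List Letter, u.length ≤ R ∧
      curvedTriple.word u 0 = tri 0 b 0 := by
    rcases le_total 0 b with h | h
    · exact ⟨List.replicate b.toNat .up, by simp; lia, by rw [hup, tri_inj]; lia⟩
    · exact ⟨List.replicate (-b).toNat .down, by simp; lia, by rw [hdown, tri_inj]; lia⟩
  obtain ⟨v, hv, hv'⟩ : ∃ v : List Letter, v.length ≤ R ∧
      curvedTriple.word v (tri 0 b 0) = tri 0 b c := by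
    rcases le_total 0 c with h | h
    · exact ⟨List.replicate c.toNat .succ, by simp; lia, by rw [hsucc, tri_inj]; lia⟩
    · exact ⟨List.replicate (-c).toNat .pred, by simp; lia, by rw [hpred, tri_inj]; lia⟩
  rcases ha with rfl | rfl
  · refine ⟨v ++ u, by rw [List.length_append]; lia, ?_⟩
    rw [Shift.word_append, hu', hv']
  · refine ⟨.next :: (v ++ u), by rw [List.length_cons, List.length_append]; lia, ?_⟩
    rw [Shift.word_cons, Shift.word_append, hu', hv', Shift.act]
    change _ + tri 1 0 0 = _
    rw [tri_add, tri_inj]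
    lia

theorem tripleBase_range {a b c : ℤ} (h₀ : -tripleBase.one ≤ tri a b c)
    (h₁ : tri a b c ≤ tripleBase.top) : a = 0 ∨ a = 1 := by
  rw [tripleBase, neg_tri, tri_le] at h₀
  rw [tripleBase, tri_le] at h₁
  lia

theorem movesAlike_curvedTriple (R : ℕ) : MovesAlike curvedTriple curvedTriple R := by
  intro x x' hx₀ hx₁ hx₀' hx₁' hc w hw
  have key : ∀ {x x' : Triple}, -tripleBase.one ≤ x → x ≤ tripleBase.top →
      SameCut curvedTriple curvedTriple (3 * R + 3) (0, 0) x x' →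
      x = x' ∨ ∀ a b c, x = tri a b c → (R < b ∨ b < -R) ∨ R < c ∨ c < -R := by
    intro x x' hx₀ hx₁ hc
    refine or_iff_not_imp_right.2 fun h => ?_
    push Not at h
    obtain ⟨a, b, c, rfl, ⟨hb, hb'⟩, hc₁, hc₂⟩ := h
    obtain ⟨v, hv, hv'⟩ := exists_word_curvedTriple (tripleBase_range hx₀ hx₁) ⟨hb', hb⟩
      ⟨hc₂, hc₁⟩
    have hcut := hc v (by lia)
    simp only [hv', lt_irrefl, false_iff, not_lt] at hcut
    exact le_antisymm hcut.2 hcut.1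
  rcases key hx₀ hx₁ hc with rfl | h
  · exact Iff.rfl
  rcases key hx₀' hx₁' hc.swap with rfl | h'
  · exact Iff.rfl
  obtain ⟨a, b, c, rfl⟩ := exists_tri x
  obtain ⟨a', b', c', rfl⟩ := exists_tri x'
  rw [word_curvedTriple_lt_iff (h _ _ _ rfl) hw, word_curvedTriple_lt_iff (h' _ _ _ rfl) hw]

end Curved

section Sentence

variable {M : Type} [S : stepLang.Structure M]

/-- The atomic formula that relates two bound variables by a relation symbol. -/
def relVar (R : StepRel 2) {n : ℕ} (i j : Fin n) : stepLang.BoundedFormula Empty n :=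
  Relations.boundedFormula₂ (R : stepLang.Relations 2) (Term.var (Sum.inr i))
    (Term.var (Sum.inr j))

theorem realize_relVar (R : StepRel 2) {n : ℕ} (i j : Fin n) (v : Empty → M) (xs : Fin n → M) :
    (relVar R i j).Realize v xs ↔ S.RelMap R ![xs i, xs j] := by
  rw [relVar, BoundedFormula.realize_rel₂]
  rfl

/-- The equality of two bound variables. -/
def eqVar {n : ℕ} (i j : Fin n) : stepLang.BoundedFormula Empty n :=
  Term.bdEqual (Term.var (Sum.inr i)) (Term.var (Sum.inr j))

theorem realize_eqVar {n : ℕ} (i j : Fin n) (v : Empty → M) (xs : Fin n → M) :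
    (eqVar i j : stepLang.BoundedFormula Empty n).Realize v xs ↔ xs i = xs j := by
  rw [eqVar, BoundedFormula.realize_bdEqual]
  rfl

/-- The domain of `step` contains no interval. -/
def noIntervalSentence : stepLang.Sentence :=
  BoundedFormula.all <| BoundedFormula.all <| (relVar .lt 0 1).imp <| BoundedFormula.ex <|
    relVar .lt 0 2 ⊓ (relVar .lt 2 1 ⊓ (BoundedFormula.ex (relVar .step 2 3)).not)

/-- The relation `step` is functional. -/
def functionalSentence : stepLang.Sentence :=
  BoundedFormula.all <| BoundedFormula.all <| BoundedFormula.all <|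
    (relVar .step 0 1).imp <| (relVar .step 0 2).imp <| eqVar 1 2

/-- The relation `step` is injective. -/
def injectiveSentence : stepLang.Sentence :=
  BoundedFormula.all <| BoundedFormula.all <| BoundedFormula.all <|
    (relVar .step 0 2).imp <| (relVar .step 1 2).imp <| eqVar 0 1

/-- The values of `step` lie in its domain. -/
def rangeSentence : stepLang.Sentence :=
  BoundedFormula.all <| BoundedFormula.all <| (relVar .step 0 1).imp <|
    BoundedFormula.ex <| relVar .step 1 2

/-- The elements of the domain of `step` are values. -/
def surjectiveSentence : stepLang.Sentence :=
  BoundedFormula.all <| BoundedFormula.all <| (relVar .step 0 1).imp <|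
    BoundedFormula.ex <| relVar .step 2 0

/-- The sentence which says that if `step` is an injective self-map of its domain and this domain
contains no interval, then `step` is surjective. -/
def pigeonholeSentence : stepLang.Sentence :=
  noIntervalSentence.imp <| functionalSentence.imp <| injectiveSentence.imp <|
    rangeSentence.imp surjectiveSentence

theorem realize_noIntervalSentence : M ⊨ noIntervalSentence ↔
    ∀ a b : M, S.RelMap StepRel.lt ![a, b] → ∃ c, S.RelMap StepRel.lt ![a, c] ∧
      S.RelMap StepRel.lt ![c, b] ∧ ¬ ∃ y, S.RelMap StepRel.step ![c, y] := by
  simp [noIntervalSentence, Sentence.Realize, Formula.Realize, realize_relVar, Fin.snoc]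

theorem realize_functionalSentence : M ⊨ functionalSentence ↔
    ∀ x y z : M, S.RelMap StepRel.step ![x, y] → S.RelMap StepRel.step ![x, z] → y = z := by
  simp [functionalSentence, Sentence.Realize, Formula.Realize, realize_relVar, realize_eqVar,
    Fin.snoc]

theorem realize_injectiveSentence : M ⊨ injectiveSentence ↔
    ∀ x y z : M, S.RelMap StepRel.step ![x, z] → S.RelMap StepRel.step ![y, z] → x = y := by
  simp [injectiveSentence, Sentence.Realize, Formula.Realize, realize_relVar, realize_eqVar,
    Fin.snoc]

theorem realize_rangeSentence : M ⊨ rangeSentence ↔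
    ∀ x y : M, S.RelMap StepRel.step ![x, y] → ∃ z, S.RelMap StepRel.step ![y, z] := by
  simp [rangeSentence, Sentence.Realize, Formula.Realize, realize_relVar, Fin.snoc]

theorem realize_surjectiveSentence : M ⊨ surjectiveSentence ↔
    ∀ x y : M, S.RelMap StepRel.step ![x, y] → ∃ z, S.RelMap StepRel.step ![z, x] := by
  simp [surjectiveSentence, Sentence.Realize, Formula.Realize, realize_relVar, Fin.snoc]

theorem realize_pigeonholeSentence : M ⊨ pigeonholeSentence ↔
    (M ⊨ noIntervalSentence → M ⊨ functionalSentence → M ⊨ injectiveSentence →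
      M ⊨ rangeSentence → M ⊨ surjectiveSentence) := by
  simp [pigeonholeSentence, Sentence.Realize, Formula.Realize]

/-- In an o-minimal structure, a definable set that contains no interval is finite. -/
theorem IsOMinimal.finite {L : FirstOrder.Language.{0, 0}} [HasLt L] {M : Type} [LinearOrder M]
    {S : L.Structure M} (hS : IsOMinimal S) {D : Set M} (hD : D ∈ definableSets S)
    (h : ∀ a b, a < b → ∃ c, a < c ∧ c < b ∧ c ∉ D) : D.Finite := by
  obtain ⟨F, hF, hI, rfl⟩ := hS.omin D hD
  have := hS.nonempty
  have := hS.noMin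
  have := hS.noMax
  refine hF.sUnion fun I hIF => ?_
  have key : ∀ a b, Set.Ioo a b ⊆ I → ¬ a < b := by
    intro a b hab hlt
    obtain ⟨c, hac, hcb, hc⟩ := h a b hlt
    exact hc ⟨I, hIF, hab ⟨hac, hcb⟩⟩
  rcases hI I hIF with ⟨a, rfl⟩ | ⟨a, b, rfl⟩ | ⟨a, rfl⟩ | ⟨b, rfl⟩ | rfl
  · exact Set.finite_singleton a
  · rw [Set.Ioo_eq_empty (key a b subset_rfl)]
    exact Set.finite_empty
  · obtain ⟨b, hb⟩ := exists_gt a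
    exact (key a b (fun x hx => hx.1) hb).elim
  · obtain ⟨a, ha⟩ := exists_lt b
    exact (key a b (fun x hx => hx.2) ha).elim
  · obtain ⟨a⟩ := hS.nonempty
    obtain ⟨b, hb⟩ := exists_gt a
    exact (key a b (fun x _ => trivial) hb).elim

theorem pigeonholeSentence_mem_ominTheory : pigeonholeSentence ∈ ominTheory stepLang := by
  intro M _ S hS
  rw [realize_pigeonholeSentence, realize_noIntervalSentence, realize_functionalSentence,
    realize_injectiveSentence, realize_rangeSentence, realize_surjectiveSentence]
  intro h₁ h₂ h₃ h₄
  have hlt : ∀ a b : M, S.RelMap StepRel.lt ![a, b] ↔ a < b := hS.lt_iff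
  simp only [hlt] at h₁
  have hfin : {x : M | ∃ y, S.RelMap StepRel.step ![x, y]}.Finite :=
    hS.finite (domain_mem_definableSets S) h₁
  have := hfin.to_subtype
  choose f hf using fun x : {x : M | ∃ y, S.RelMap StepRel.step ![x, y]} => x.2
  let g : {x : M | ∃ y, S.RelMap StepRel.step ![x, y]} →
      {x : M | ∃ y, S.RelMap StepRel.step ![x, y]} := fun x => ⟨f x, h₄ _ _ (hf x)⟩
  have hg : Function.Injective g := by
    intro x y hxy
    have e : f x = f y := congrArg Subtype.val hxy
    exact Subtype.ext (h₃ _ _ _ (hf x) (e ▸ hf y))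
  intro x y hxy
  obtain ⟨z, hz⟩ := Finite.surjective_of_injective hg ⟨x, y, hxy⟩
  have e : f z = x := congrArg Subtype.val hz
  exact ⟨z, e ▸ hf z⟩

end Sentence

section Grid

variable {A : Type} [AddCommGroup A] [LinearOrder A] [IsOrderedAddMonoid A] {B : Base A}

/-- The integral point with a given integral part in `[0, top)`. -/
def gridPoint (B : Base A) (d : A) (h₀ : 0 ≤ d) (h₁ : d < B.top) : Pts B :=
  Pts.mk B d 0 le_rfl one_pos ((neg_nonpos.2 B.one_pos.le).trans h₀) h₁.le fun e =>
    ((neg_neg_iff_pos.2 B.one_pos).trans_le h₀).ne' e |>.elim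

theorem gridPoint_mem (d : A) (h₀ : 0 ≤ d) (h₁ : d < B.top) : gridPoint B d h₀ h₁ ∈ grid B :=
  ⟨rfl, h₀, h₁⟩

theorem exists_step (G : Shift B)
    (h : ∀ d, 0 ≤ d → d < B.top → 0 ≤ G.up d ∧ G.up d < B.top + B.top) :
    ∀ x ∈ grid B, ∃ y, G.Step x y := by
  intro x hx
  obtain ⟨h₀, h₁⟩ := h x.floor hx.2.1 hx.2.2
  by_cases hlt : G.up x.floor < B.top
  · exact ⟨gridPoint B _ h₀ hlt, hx, gridPoint_mem _ _ _, Or.inl rfl⟩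
  · exact ⟨gridPoint B (G.up x.floor - B.top) (sub_nonneg.2 (not_lt.1 hlt))
      (sub_lt_iff_lt_add.2 h₁), hx, gridPoint_mem _ _ _, Or.inr (sub_add_cancel _ _)⟩

theorem exists_Ioo_inter_grid (x : Pts B) :
    ∃ a b, a < x ∧ x < b ∧ ∀ y ∈ grid B, a < y → y < b → y = x := by
  have h₀ := x.fract_nonneg
  have h₁ := x.fract_lt_one
  have hb : x < Pts.mk B x.floor ((x.fract + 1) / 2) (by linarith) (by linarith)
      x.neg_one_le_floor x.floor_le_top fun _ => by linarith :=
    Pts.lt_iff.2 (Or.inr ⟨rfl, by rw [Pts.fract_mk]; linarith⟩)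
  rcases h₀.eq_or_lt with hx | hx
  · have hlt : -B.one < x.floor :=
      x.neg_one_le_floor.lt_of_ne fun e => (x.fract_pos e.symm).ne hx
    have hle : -B.one ≤ x.floor - B.one := by
      rw [B.lt_iff, neg_add_cancel] at hlt
      rwa [le_sub_iff_add_le, neg_add_cancel]
    refine ⟨Pts.mk B (x.floor - B.one) (1 / 2) (by norm_num) (by norm_num) hle
      ((sub_le_self _ B.one_pos.le).trans x.floor_le_top) fun _ => by norm_num, _,
      Pts.lt_iff.2 (Or.inl (sub_lt_self _ B.one_pos)), hb, fun y hy hay hyb => ?_⟩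
    have hyx : y.floor ≤ x.floor := by
      rcases Pts.lt_iff.1 hyb with h | h
      · exact h.le
      · exact h.1.le
    rcases Pts.lt_iff.1 hay with h | h
    · rw [Pts.floor_mk, B.lt_iff, sub_add_cancel] at h
      exact Pts.ext (le_antisymm hyx h) (hy.1.trans hx)
    · have := h.2
      rw [Pts.fract_mk, hy.1] at this
      norm_num at this
  · refine ⟨Pts.mk B x.floor (x.fract / 2) (by linarith) (by linarith) x.neg_one_le_floor
      x.floor_le_top fun _ => by linarith, _,
      Pts.lt_iff.2 (Or.inr ⟨rfl, by rw [Pts.fract_mk]; linarith⟩), hb, fun y hy hay hyb => ?_⟩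
    rcases Pts.lt_iff.1 hay with h | h
    · rcases Pts.lt_iff.1 hyb with h' | h'
      · exact (lt_asymm h h').elim
      · exact (h.ne' h'.1).elim
    · have := h.2
      rw [Pts.fract_mk, hy.1] at this
      linarith

theorem isPseudoFinite_grid (G : Shift B) (htot : ∀ x ∈ grid B, ∃ y, G.Step x y) :
    IsPseudoFinite G.str {v : Fin 1 → Pts B | v 0 ∈ grid B} := by
  let : TopologicalSpace (Pts B) := Preorder.topology (Pts B)
  have : OrderTopology (Pts B) := ⟨rfl⟩
  have hnhds : ∀ v : Fin 1 → Pts B, ∀ᶠ u in nhds v, u 0 ∈ grid B → u = v := by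
    intro v
    obtain ⟨a, b, ha, hb, h⟩ := exists_Ioo_inter_grid (v 0)
    filter_upwards [(continuous_apply 0).continuousAt.preimage_mem_nhds (Ioo_mem_nhds ha hb)]
      with u hu hug
    funext i
    rw [Subsingleton.elim i 0]
    exact h _ hug hu.1 hu.2
  refine ⟨grid_mem_definableSets G htot, ?_, ⟨?_, ?_⟩, ?_⟩
  · rw [← isOpen_compl_iff, isOpen_iff_mem_nhds]
    intro v hv
    filter_upwards [hnhds v] with u hu hug
    exact hv (hu hug ▸ hug)
  · refine ⟨fun _ => Pts.mk B (-B.one) (1 / 2) (by norm_num) (by norm_num) le_rfl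
      ((neg_nonpos.2 B.one_pos.le).trans B.top_pos.le) fun _ => by norm_num, fun v hv i => ?_⟩
    rw [Subsingleton.elim i 0]
    exact (Pts.lt_iff.2 (Or.inl ((neg_neg_iff_pos.2 B.one_pos).trans_le hv.2.1))).le
  · refine ⟨fun _ => Pts.mk B B.top 0 le_rfl one_pos
      ((neg_nonpos.2 B.one_pos.le).trans B.top_pos.le) le_rfl fun e =>
      (((neg_neg_iff_pos.2 B.one_pos).trans B.top_pos).ne' e).elim, fun v hv i => ?_⟩
    rw [Subsingleton.elim i 0]
    exact (Pts.lt_iff.2 (Or.inl hv.2.2)).le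
  · refine IsDiscrete.of_nhdsWithin fun v _ => ?_
    rw [Filter.le_pure_iff, mem_nhdsWithin_iff_eventually]
    filter_upwards [hnhds v] with u hu hug
    exact hu hug

theorem step_functional (G : Shift B) {x y z : Pts B} (hy : G.Step x y) (hz : G.Step x z) :
    y = z := by
  obtain ⟨-, hy₁, hy₂⟩ := hy
  obtain ⟨-, hz₁, hz₂⟩ := hz
  refine Pts.ext ?_ (hy₁.1.trans hz₁.1.symm)
  rcases hy₂ with h | h <;> rcases hz₂ with h' | h'
  · rw [h, h']
  · have := hy₁.2.2
    rw [h, ← h'] at this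
    exact (this.not_ge (le_add_of_nonneg_left hz₁.2.1)).elim
  · have := hz₁.2.2
    rw [h', ← h] at this
    exact (this.not_ge (le_add_of_nonneg_left hy₁.2.1)).elim
  · exact add_right_cancel (h.trans h'.symm)

end Grid

section Triples

theorem exists_tri_of_mem_grid {x : Pts tripleBase} (hx : x ∈ grid tripleBase) :
    ∃ a b c, x.floor = tri a b c ∧ (a = 0 ∧ (0 < b ∨ b = 0 ∧ 0 ≤ c) ∨
      a = 1 ∧ (b < 0 ∨ b = 0 ∧ c < 0)) := by
  obtain ⟨a, b, c, h⟩ := exists_tri x.floor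
  have h₀ := hx.2.1
  have h₁ := hx.2.2
  rw [h, zero_eq_tri, tri_le] at h₀
  rw [h, tripleBase, tri_lt] at h₁
  exact ⟨a, b, c, h, by lia⟩

theorem exists_step_flatTriple : ∀ x ∈ grid tripleBase, ∃ y, flatTriple.Step x y := by
  refine exists_step _ fun d h₀ h₁ => ?_
  obtain ⟨a, b, c, rfl⟩ := exists_tri d
  change 0 ≤ tri a b c + tri 0 1 0 ∧ tri a b c + tri 0 1 0 < tri 1 0 0 + tri 1 0 0
  rw [tripleBase, tri_lt] at h₁
  rw [zero_eq_tri, tri_le] at h₀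
  rw [tri_add, tri_add, zero_eq_tri, tri_le, tri_lt]
  lia

theorem exists_step_curvedTriple : ∀ x ∈ grid tripleBase, ∃ y, curvedTriple.Step x y := by
  refine exists_step _ fun d h₀ h₁ => ?_
  obtain ⟨a, b, c, rfl⟩ := exists_tri d
  rw [tripleBase, tri_lt] at h₁
  rw [zero_eq_tri, tri_le] at h₀
  rw [curvedTriple_up]
  change 0 ≤ _ ∧ _ < tri 1 0 0 + tri 1 0 0
  rw [tri_add, zero_eq_tri, tri_le, tri_lt]
  lia

theorem step_curvedTriple_injective {x y z : Pts tripleBase} (hx : curvedTriple.Step x z)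
    (hy : curvedTriple.Step y z) : x = y := by
  obtain ⟨hx₁, hz, hx₂⟩ := hx
  obtain ⟨hy₁, -, hy₂⟩ := hy
  refine Pts.ext ?_ (hx₁.1.trans hy₁.1.symm)
  obtain ⟨a, b, c, h, hx₃⟩ := exists_tri_of_mem_grid hx₁
  obtain ⟨a', b', c', h', hy₃⟩ := exists_tri_of_mem_grid hy₁
  obtain ⟨a'', b'', c'', h'', hz₃⟩ := exists_tri_of_mem_grid hz
  rw [h, h'', curvedTriple_up, tripleBase, tri_add, tri_inj, tri_inj] at hx₂
  rw [h', h'', curvedTriple_up, tripleBase, tri_add, tri_inj, tri_inj] at hy₂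
  rw [h, h', tri_inj]
  split_ifs at hx₂ hy₂ <;> lia

/-- The point `0` of the grid. -/
def gridZero : Pts tripleBase := gridPoint tripleBase 0 le_rfl tripleBase.top_pos

theorem not_step_gridZero (x : Pts tripleBase) : ¬ curvedTriple.Step x gridZero := by
  rintro ⟨hx, -, h⟩
  obtain ⟨a, b, c, h', -⟩ := exists_tri_of_mem_grid hx
  change tri 0 0 0 = _ ∨ tri 0 0 0 + tri 1 0 0 = _ at h
  rw [h', curvedTriple_up, tri_add, tri_inj, tri_inj] at h
  split_ifs at h <;> lia

theorem not_pigeonholePrinciple_curvedTriple : ¬ PigeonholePrinciple curvedTriple.str := by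
  intro h
  let := curvedTriple.str
  choose f hf using fun x : {v : Fin 1 → Pts tripleBase | v 0 ∈ grid tripleBase} =>
    exists_step_curvedTriple _ x.2
  let g : {v : Fin 1 → Pts tripleBase | v 0 ∈ grid tripleBase} →
      {v : Fin 1 → Pts tripleBase | v 0 ∈ grid tripleBase} := fun x => ⟨fun _ => f x, (hf x).2.1⟩
  have hdef : (Set.univ : Set (Pts tripleBase)).Definable stepLang (graphOf g) := by
    refine Set.definable_iff_exists_formula_sum.2 ⟨Relations.formula₂
      (StepRel.step : stepLang.Relations 2) (Term.var (Sum.inr (Sum.inl 0)))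
      (Term.var (Sum.inr (Sum.inr 0))), ?_⟩
    ext z
    simp only [Set.mem_ofPred_eq, Formula.realize_rel₂, Term.realize_var, Sum.elim_inr]
    change z ∈ graphOf g ↔ curvedTriple.Step (z (Sum.inl 0)) (z (Sum.inr 0))
    constructor
    · rintro ⟨x, rfl⟩
      exact hf x
    · intro hz
      let x : {v : Fin 1 → Pts tripleBase | v 0 ∈ grid tripleBase} :=
        ⟨fun _ => z (Sum.inl 0), hz.1⟩
      refine ⟨x, ?_⟩
      funext i
      rcases i with i | i
      · rw [Subsingleton.elim i 0]
        rfl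
      · rw [Subsingleton.elim i 0]
        exact step_functional curvedTriple hz (hf x)
  have hinj : Function.Injective g := by
    intro x y hxy
    have e : f x = f y := congrFun (congrArg Subtype.val hxy) 0
    refine Subtype.ext (funext fun i => ?_)
    rw [Subsingleton.elim i 0]
    exact step_curvedTriple_injective (hf x) (e ▸ hf y)
  obtain ⟨x, hx⟩ := h 1 _ (isPseudoFinite_grid curvedTriple exists_step_curvedTriple) g hdef hinj
    ⟨fun _ => gridZero, gridPoint_mem _ _ _⟩
  have e : f x = gridZero := congrFun (congrArg Subtype.val hx) 0
  exact not_step_gridZero _ (e ▸ hf x)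

theorem not_isPseudoOMinimal_curvedTriple : ¬ IsPseudoOMinimal curvedTriple.str := by
  intro h
  let := curvedTriple.str
  have hσ := (Theory.model_iff _).1 h _ pigeonholeSentence_mem_ominTheory
  rw [realize_pigeonholeSentence, realize_noIntervalSentence, realize_functionalSentence,
    realize_injectiveSentence, realize_rangeSentence, realize_surjectiveSentence] at hσ
  obtain ⟨y, hy⟩ := exists_step_curvedTriple gridZero (gridPoint_mem _ _ _)
  have hdense := (expandsDLO curvedTriple).dense
  refine (fun ⟨z, hz⟩ => not_step_gridZero z hz : ¬ ∃ z, curvedTriple.Step z gridZero)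
    (hσ (fun a b hab => ?_) (fun x y z hy hz => step_functional curvedTriple hy hz)
      (fun x y z hx hy => step_curvedTriple_injective hx hy)
      (fun x y hxy => exists_step_curvedTriple y hxy.2.1) gridZero y hy)
  change a < b at hab
  obtain ⟨c, hac, hcb⟩ := exists_between hab
  obtain ⟨a', b', ha', hb', hc⟩ := exists_Ioo_inter_grid c
  obtain ⟨d, hd, hdc⟩ := exists_between (max_lt hac ha')
  refine ⟨d, (le_max_left _ _).trans_lt hd, hdc.trans hcb, ?_⟩
  rintro ⟨y, hy⟩
  exact hdc.ne (hc d hy.1 ((le_max_right _ _).trans_lt hd) (hdc.trans hb'))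

end Triples

end PseudoOMin

theorem mainTheorem1 :
    ∃ (L : FirstOrder.Language.{0, 0}) (_ : PseudoOMin.HasLt L),
      -- two expansions of the same dense linear order, with the same one-variable definable sets
      (∃ (M : Type) (_ : LinearOrder M) (S₁ S₂ : L.Structure M),
        PseudoOMin.ExpandsDLO S₁ ∧ PseudoOMin.ExpandsDLO S₂ ∧
        PseudoOMin.definableSets S₁ = PseudoOMin.definableSets S₂ ∧
        PseudoOMin.IsPseudoOMinimal S₁ ∧
        ¬ PseudoOMin.PigeonholePrinciple S₂ ∧
        ¬ PseudoOMin.IsPseudoOMinimal S₂) ∧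
      -- no axiomatization by first-order conditions on one-variable formulae
      (¬ ∃ C : Set PseudoOMin.langLtU.Sentence,
        ∀ (K : Type) (_ : Nonempty K) (S : L.Structure K),
          K ⊨ (⋃ τ ∈ C, PseudoOMin.conditionScheme L τ : L.Theory) ↔ PseudoOMin.IsPseudoOMinimal S) ∧
      -- no axiomatization by a second-order theory in the language with `<` and `Def`
      (¬ ∃ T : Set PseudoOMin.SOSentence,
        ∀ (K : Type) (_ : Nonempty K) (S : L.Structure K),
          (∀ σ ∈ T, PseudoOMin.SOSatisfies S σ) ↔ PseudoOMin.IsPseudoOMinimal S) := by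
  have h₁ := PseudoOMin.expandsDLO PseudoOMin.flatTriple
  have h₂ := PseudoOMin.expandsDLO PseudoOMin.curvedTriple
  have hlt := h₁.ltRel_eq h₂
  have hdef : PseudoOMin.definableSets PseudoOMin.flatTriple.str =
      PseudoOMin.definableSets PseudoOMin.curvedTriple.str := by
    rw [PseudoOMin.definableSets_eq PseudoOMin.flatTriple
        (fun R => PseudoOMin.movesAlike_flatShift fun _ _ => Iff.rfl)
        PseudoOMin.exists_step_flatTriple,
      PseudoOMin.definableSets_eq PseudoOMin.curvedTriple PseudoOMin.movesAlike_curvedTriple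
        PseudoOMin.exists_step_curvedTriple]
  have hM := PseudoOMin.isPseudoOMinimal_flatTriple
  have hN := PseudoOMin.not_isPseudoOMinimal_curvedTriple
  refine ⟨PseudoOMin.stepLang, inferInstance, ⟨_, inferInstance, PseudoOMin.flatTriple.str,
    PseudoOMin.curvedTriple.str, h₁, h₂, hdef, hM,
    PseudoOMin.not_pigeonholePrinciple_curvedTriple, hN⟩, ?_, ?_⟩
  · rintro ⟨C, hC⟩
    exact hN ((hC _ h₂.nonempty _).1 (PseudoOMin.models_iUnion_conditionScheme_congr hlt hdef C
      ((hC _ h₁.nonempty _).2 hM)))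
  · rintro ⟨T, hT⟩
    exact hN ((hT _ h₂.nonempty _).1 fun σ hσ => PseudoOMin.SOSatisfies_congr hlt hdef σ
      ((hT _ h₁.nonempty _).2 hM σ hσ))
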